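/- **Setting.** There are $k\ge 2$ arms with unknown distributions $F_1,\dots,F_k$ on $\mathbb R$, and a contamination level $\varepsilon$. In round $t=1,2,\dots$ an algorithm, possibly randomized (with randomness independent of the data), uses its past observations either to stop and output an arm $\hat I$, or to pull an arm $i$ and observe $X_{i,t}=(1-D_{i,t})Y_{i,t}+D_{i,t}Z_{i,t}$. Here $Y_{i,t}\sim F_i$ and $D_{i,t}\sim\mathrm{Ber}(\varepsilon)$. For each arm $i$: * *oblivious adversary*: the triples $(Y_{i,t},D_{i,t},Z_{i,t})_{t\ge1}$ are independent over $t$, and $Y_{i,t}$ and $D_{i,t}$ are independent of each other for every $t$; * *prescient adversary*: the pairs $(Y_{i,t},D_{i,t})_{t\ge1}$ are independent over $t$, $Y_{i,t}$ and $D_{i,t}$ are independent of each other for every $t$, and the $Z_{i,t}$ are arbitrary; * *malicious adversary*: the pairs $(Y_{i,t},D_{i,t})_{t\ge1}$ are independent over $t$, and the $Z_{i,t}$ are arbitrary. No independence across arms is required. An *instance* consists of $F_1,\dots,F_k$ and a joint law of all the triples. $T$ denotes the number of samples taken ($T=\infty$ if the algorithm never stops). For a distribution $F$ (identified with its cdf)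 let $Q_{L,F}(p)=\inf\{x:F(x)\ge p\}$ and $Q_{R,F}(p)=\inf\{x:F(x)>p\}$. $F$ has a unique median if $Q_{L,F}(\frac12)=Q_{R,F}(\frac12)=:m_1(F)$, and $m_2(F)$ is then the median of $|X-m_1(F)|$, $X\sim F$. For $\bar t\in(0,\frac12)$ and $B>0$, $\mathcal F_{\bar t,B}$ is the family of distributions $F$ with unique median, with $m_2(F)$ well defined (the law of $|X-m_1(F)|$ has a unique median) and positive, such that $|F(x_1)-F(x_2)|\ge \frac{1}{B\,m_2(F)}|x_1-x_2|$ for all $x_1,x_2\in[Q_{L,F}(\tfrac12-\bar t),Q_{R,F}(\tfrac12+\bar t)]$. Put $U_i=B\,m_2(F_i)\frac{\varepsilon}{2(1-\varepsilon)}$ for oblivious and prescient adversaries and $U_i=B\,m_2(F_i)\,\varepsilon$ for malicious ones. With $i^*$ an arm of highest median, the *effective gap* of arm $i$ is $\tilde\Delta_i=(m_1(F_{i^*})-U_{i^*})-(m_1(F_i)+U_i)$. For $\bar m_2>0$, consider the class of instances, for the given type of adversary and level $\varepsilon$, with all $F_i\in\mathcal F_{\bar t,B}$, all $m_2(F_i)\le\bar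 m_2$, and $\tilde\Delta_i>0$ for all $i\ne i^*$. An algorithm is *$(\alpha,\delta)$-PAC* if on every instance of this class it satisfies $\mathbb P(T<\infty\text{ and }\tilde\Delta_{\hat I}\le\alpha)\ge1-\delta$. **Theorem 4.3.** There are constants $B>0$, $\bar m_2>0$ and $c>0$ such that the following holds against each type of adversary (oblivious, prescient or malicious). For all $k\ge2$, $\delta\in(0,\frac3{20})$, $\alpha\in(0,\frac16)$, $\varepsilon\in(0,\frac1{15})$, $\bar t\in(0,\frac1{10})$, $i^*\in\{1,\dots,k\}$, and all prescribed values $(\tilde\Delta_i)_{i\ne i^*}$ in $(0,\frac13)$, there is an instance in the above class (so that $F_1,\dots,F_k\in\mathcal F_{\bar t,B}$) with best arm $i^*$ and with these effective gaps, on which every $(\alpha,\delta)$-PAC algorithm has expected sample complexity $$\mathbb E[T]\;\ge\; c\sum_{i\ne i^*}\frac{1}{\max(\tilde\Delta_i,\alpha)^2}\,\log\frac1\delta .$$ -/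

import Mathlib

open MeasureTheory ProbabilityTheory

noncomputable section

namespace CBAI

/-- Left quantile `inf {x : F(x) ≥ p}`; it is used only for `p` strictly between 0 and 1. -/
def leftQuantile (F : Measure ℝ) (p : ℝ) : ℝ := sInf {x : ℝ | p ≤ cdf F x}

/-- Right quantile `inf {x : F(x) > p}`; it is used only for `p` strictly between 0 and 1. -/
def rightQuantile (F : Measure ℝ) (p : ℝ) : ℝ := sInf {x : ℝ | p < cdf F x}

/-- The interval of medians reduces to one point. -/
def HasUniqueMedian (F : Measure ℝ) : Prop :=
  leftQuantile F (1 / 2) = rightQuantile F (1 / 2)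

/-- The median `m₁(F)` of a distribution with a unique median. -/
def median (F : Measure ℝ) : ℝ := leftQuantile F (1 / 2)

/-- The law of `|X - m₁(F)|` for `X` with law `F`. -/
def absDeviation (F : Measure ℝ) : Measure ℝ := F.map (fun x => |x - median F|)

/-- The median absolute deviation `m₂(F)`. -/
def mad (F : Measure ℝ) : ℝ := median (absDeviation F)

/-- The family of distributions with a unique median whose cdf grows at least linearly, with slope
`1 / (B m₂(F))`, on the quantile range `1/2 ± t`. That `m₂(F)` is a well defined positive number
is presupposed by the slope and is recorded explicitly. -/
structure InFamily (t B : ℝ) (F : Measure ℝ) : Prop where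
  unique_median : HasUniqueMedian F
  unique_mad : HasUniqueMedian (absDeviation F)
  mad_pos : 0 < mad F
  growth : ∀ x₁ ∈ Set.Icc (leftQuantile F (1 / 2 - t)) (rightQuantile F (1 / 2 + t)),
    ∀ x₂ ∈ Set.Icc (leftQuantile F (1 / 2 - t)) (rightQuantile F (1 / 2 + t)),
      1 / (B * mad F) * |x₁ - x₂| ≤ |cdf F x₁ - cdf F x₂|

/-- The three adversarial settings. -/
inductive Adversary where
  | oblivious
  | prescient
  | malicious

/-- The unavoidable uncertainty in median estimation, as a function of the contamination level,
of `B`, and of the median absolute deviation. -/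
def uncertainty (adv : Adversary) (ε B m₂ : ℝ) : ℝ :=
  match adv with
  | .oblivious => B * m₂ * (ε / (2 * (1 - ε)))
  | .prescient => B * m₂ * (ε / (2 * (1 - ε)))
  | .malicious => B * m₂ * ε

/-- All triples `(Y i t, D i t, Z i t)`, for the arms `i` and the rounds `t`. -/
abbrev Triples (k : ℕ) : Type := Fin k → ℕ → ℝ × Bool × ℝ

/-- The contaminated sample `X = (1 - D) Y + D Z` of arm `i` in round `t`. -/
def sample {k : ℕ} (e : Triples k) (i : Fin k) (t : ℕ) : ℝ :=
  if (e i t).2.1 = true then (e i t).2.2 else (e i t).1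

/-- A contaminated bandit instance: the true distributions of the arms, and the joint law of all
the triples `(Y, D, Z)`. -/
structure Instance (k : ℕ) where
  dist : Fin k → ProbabilityMeasure ℝ
  law : ProbabilityMeasure (Triples k)

/-- The joint law of the triples is one that the given adversary can produce at contamination
level `ε`. There is no independence requirement across arms. -/
structure Instance.Admissible {k : ℕ} (ν : Instance k) (adv : Adversary) (ε : ℝ) : Prop where
  /-- `Y i t` has law `F i`. -/
  law_Y : ∀ i t, (ν.law : Measure (Triples k)).map (fun e => (e i t).1) = (ν.dist i : Measure ℝ)
  /-- `D i t` is Bernoulli with parameter `ε`. -/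
  law_D : ∀ i t, (ν.law : Measure (Triples k)) {e | (e i t).2.1 = true} = ENNReal.ofReal ε
  /-- For each arm, the pairs `(Y i t, D i t)` are independent over the rounds. -/
  indep_pairs : ∀ i, iIndepFun (fun (t : ℕ) (e : Triples k) => ((e i t).1, (e i t).2.1))
    (ν.law : Measure (Triples k))
  /-- Unless the adversary is malicious, `Y i t` and `D i t` are independent. -/
  indep_Y_D : adv ≠ .malicious → ∀ i t,
    IndepFun (fun e : Triples k => (e i t).1) (fun e : Triples k => (e i t).2.1)
      (ν.law : Measure (Triples k))
  /-- If the adversary is oblivious then, for each arm, the whole triples are independent over the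
  rounds. -/
  indep_triples : adv = .oblivious → ∀ i, iIndepFun (fun (t : ℕ) (e : Triples k) => e i t)
    (ν.law : Measure (Triples k))

/-- Arm `i` has the highest median. -/
def Instance.IsBest {k : ℕ} (ν : Instance k) (i : Fin k) : Prop :=
  ∀ j, median (ν.dist j) ≤ median (ν.dist i)

/-- The effective gap `(m₁(F b) - U b) - (m₁(F i) + U i)` of arm `i` with respect to the best
arm `b`. -/
def Instance.effectiveGap {k : ℕ} (ν : Instance k) (adv : Adversary) (ε B : ℝ) (b i : Fin k) : ℝ :=
  (median (ν.dist b) - uncertainty adv ε B (mad (ν.dist b))) -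
    (median (ν.dist i) + uncertainty adv ε B (mad (ν.dist i)))

/-- The instances under consideration: the adversary respects its rules, all arms lie in the
family with parameters `t` and `B` and have median absolute deviation at most `M`, the arm `b` is
the best one, and all other arms have positive effective gap. -/
structure Instance.InClass {k : ℕ} (ν : Instance k) (adv : Adversary) (ε t B M : ℝ)
    (b : Fin k) : Prop where
  admissible : ν.Admissible adv ε
  family : ∀ i, InFamily t B (ν.dist i)
  mad_le : ∀ i, mad (ν.dist i) ≤ M
  best : ν.IsBest b
  gap_pos : ∀ i, i ≠ b → 0 < ν.effectiveGap adv ε B b i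

/-- A randomized sequential algorithm for `k` arms. In round `n` it knows its random seed and the
`n` samples it has received so far (the arms pulled so far are a function of these), and it decides
whether to stop, which arm to pull if it goes on, and which arm to output if it stops. -/
structure Algorithm (k : ℕ) where
  Seed : Type
  [measurableSpaceSeed : MeasurableSpace Seed]
  seedLaw : ProbabilityMeasure Seed
  halt : (n : ℕ) → Set (Seed × (Fin n → ℝ))
  pull : (n : ℕ) → Seed × (Fin n → ℝ) → Fin k
  output : (n : ℕ) → Seed × (Fin n → ℝ) → Fin k
  measurableSet_halt : ∀ n, MeasurableSet (halt n)
  measurable_pull : ∀ n, Measurable (pull n)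
  measurable_output : ∀ n, Measurable (output n)

attribute [instance] Algorithm.measurableSpaceSeed

namespace Algorithm

variable {k : ℕ} (A : Algorithm k)

/-- The first `n` samples received (when the stopping rule is ignored): in round `n` the algorithm
pulls the arm it has chosen and receives the sample of this arm in this round. -/
def history (s : A.Seed) (e : Triples k) : (n : ℕ) → (Fin n → ℝ)
  | 0 => Fin.elim0
  | n + 1 => Fin.snoc (α := fun _ => ℝ) (history s e n)
      (sample e (A.pull n (s, history s e n)) n)

/-- The number `T` of samples taken, infinite if the algorithm never stops. -/
def sampleCount (s : A.Seed) (e : Triples k) : ℕ∞ :=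
  ⨅ (n : ℕ) (_ : (s, A.history s e n) ∈ A.halt n), (n : ℕ∞)

/-- The joint law of the seed and the triples; the seed is independent of the instance. -/
def jointLaw (ν : Instance k) : Measure (A.Seed × Triples k) :=
  (A.seedLaw : Measure A.Seed).prod (ν.law : Measure (Triples k))

/-- The expected sample complexity on the instance `ν`. -/
def expectedSamples (ν : Instance k) : ENNReal :=
  ∫⁻ p, (A.sampleCount p.1 p.2 : ENNReal) ∂(A.jointLaw ν)

/-- The algorithm is `(α, δ)`-PAC: on every instance of the class, with probability at least
`1 - δ`, it stops and outputs an arm with effective gap at most `α`, that is, an arm `i` with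
`m₁(F i) ≥ max_j m₁(F j) - (α + U b + U i)`, where `b` is the best arm. -/
def IsPAC (adv : Adversary) (ε t B M α δ : ℝ) : Prop :=
  ∀ (ν : Instance k) (b : Fin k), ν.InClass adv ε t B M b →
    ENNReal.ofReal (1 - δ) ≤ A.jointLaw ν
      {p | ∃ n : ℕ, A.sampleCount p.1 p.2 = (n : ℕ∞) ∧
        ν.effectiveGap adv ε B b (A.output n (p.1, A.history p.1 p.2 n)) ≤ α}

end Algorithm

end CBAI

end

/-! The adversary hides each true median behind an observed one, and the samples carry no trace of
the direction of the displacement. All true laws have density 1/10 near the median and atoms at ±4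
that absorb the remaining mass. Their median absolute deviation is 5/2, so with `B = 4` the growth
condition holds with equality and the uncertainty `U` is exactly the distance by which contamination
at an atom can move the median. The adversary pulls the best arm down by `U` and pushes the others
up by `U`. Effective gaps then equal differences of observed medians `θ`
(`hardInstance_effectiveGap`), and the law of the samples of an arm depends on `θ` alone, not on
whether that arm is the best one (`armTriple_map_mix`).

The rest is a lower bound by change of measure. On the hard instance the best arm has `θ = 0` and
arm `i` has `θ = -Δ i`. For any arm `j`, raise its observed median to `2α`. In this alternative `j`
is the best arm, every other arm has effective gap above `α`, and only the samples of `j` have a new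
law. A PAC algorithm therefore stops with an output other than `j` with probability at most `δ`
there. On the original instance all arms except at most one are output with probability at most 1/2,
so for every other `j` an output different from `j` has probability at least about 1/2.

Comparing these probabilities (`neg_integral_stoppedLlr_ge`) bounds the expected log-likelihood
ratio at the stopping time from below by a multiple of `log (1/δ)`. A Wald argument
(`neg_integral_stoppedLlr_le`) and the quadratic divergence bound `integral_log_obsDensity` bound it
from above by `(2α - θ j)² / 5` times the expected number of pulls of `j`. Since the shift is at
most `3 max (-θ j) α`, summing over `j` gives the claim. The omitted arm need not be the best arm,
but the best arm has the largest weight `1/α²`, so omitting another one loses nothing. -/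

open MeasureTheory ProbabilityTheory

noncomputable section

namespace CBAI

/-! ### Laws whose cdf is linear near the median -/

section Quantiles

variable {F : Measure ℝ} {m s w p : ℝ}

lemma setOf_le_cdf_eq_Ici (hs : 0 < s)
    (h : ∀ x ∈ Set.Icc (m - w) (m + w), cdf F x = 1 / 2 + s * (x - m))
    (hp : |p - 1 / 2| < s * w) :
    {x : ℝ | p ≤ cdf F x} = Set.Ici (m + (p - 1 / 2) / s) := by
  obtain ⟨h1, h2⟩ := abs_lt.1 hp
  have hq1 : (p - 1 / 2) / s < w := by rw [div_lt_iff₀ hs]; linarith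
  have hq2 : -w < (p - 1 / 2) / s := by rw [lt_div_iff₀ hs]; linarith
  have hq3 : s * ((p - 1 / 2) / s) = p - 1 / 2 := by field_simp
  generalize (p - 1 / 2) / s = q at *
  ext x
  simp only [Set.mem_ofPred_eq, Set.mem_Ici]
  constructor
  · intro hx
    by_contra! hlt
    -- The point `x` may lie left of the window, where nothing is known about the cdf; it is moved
    -- to the window's edge.
    have hy : max x (m - w) < m + q := max_lt hlt (by linarith)
    have hmono := monotone_cdf F (le_max_left x (m - w))
    rw [h (max x (m - w)) ⟨le_max_right _ _, by linarith⟩] at hmono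
    have := mul_lt_mul_of_pos_left (sub_lt_iff_lt_add'.2 hy) hs
    linarith
  · intro hx
    have hmono := monotone_cdf F hx
    rw [h (m + q) ⟨by linarith, by linarith⟩] at hmono
    have : s * (m + q - m) = p - 1 / 2 := by rw [add_sub_cancel_left, hq3]
    linarith

lemma setOf_lt_cdf_eq_Ioi (hs : 0 < s)
    (h : ∀ x ∈ Set.Icc (m - w) (m + w), cdf F x = 1 / 2 + s * (x - m))
    (hp : |p - 1 / 2| < s * w) :
    {x : ℝ | p < cdf F x} = Set.Ioi (m + (p - 1 / 2) / s) := by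
  obtain ⟨h1, h2⟩ := abs_lt.1 hp
  have hq1 : (p - 1 / 2) / s < w := by rw [div_lt_iff₀ hs]; linarith
  have hq2 : -w < (p - 1 / 2) / s := by rw [lt_div_iff₀ hs]; linarith
  have hq3 : s * ((p - 1 / 2) / s) = p - 1 / 2 := by field_simp
  generalize (p - 1 / 2) / s = q at *
  ext x
  simp only [Set.mem_ofPred_eq, Set.mem_Ioi]
  constructor
  · intro hx
    by_contra! hle
    have hmono := monotone_cdf F hle
    rw [h (m + q) ⟨by linarith, by linarith⟩] at hmono
    have : s * (m + q - m) = p - 1 / 2 := by rw [add_sub_cancel_left, hq3]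
    linarith
  · intro hx
    have hy : m + q < min x (m + w) := lt_min hx (by linarith)
    have hmono := monotone_cdf F (min_le_left x (m + w))
    rw [h (min x (m + w)) ⟨by linarith, min_le_right _ _⟩] at hmono
    have := mul_lt_mul_of_pos_left (lt_sub_iff_add_lt'.2 hy) hs
    linarith

lemma leftQuantile_eq_of_cdf_linear (hs : 0 < s)
    (h : ∀ x ∈ Set.Icc (m - w) (m + w), cdf F x = 1 / 2 + s * (x - m))
    (hp : |p - 1 / 2| < s * w) : leftQuantile F p = m + (p - 1 / 2) / s := by
  rw [leftQuantile, setOf_le_cdf_eq_Ici hs h hp, csInf_Ici]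

lemma rightQuantile_eq_of_cdf_linear (hs : 0 < s)
    (h : ∀ x ∈ Set.Icc (m - w) (m + w), cdf F x = 1 / 2 + s * (x - m))
    (hp : |p - 1 / 2| < s * w) : rightQuantile F p = m + (p - 1 / 2) / s := by
  rw [rightQuantile, setOf_lt_cdf_eq_Ioi hs h hp, csInf_Ioi]

lemma hasUniqueMedian_of_cdf_linear (hs : 0 < s) (hw : 0 < w)
    (h : ∀ x ∈ Set.Icc (m - w) (m + w), cdf F x = 1 / 2 + s * (x - m)) :
    HasUniqueMedian F := by
  have hp : |(1 / 2 : ℝ) - 1 / 2| < s * w := by rw [sub_self, abs_zero]; positivity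
  rw [HasUniqueMedian, leftQuantile_eq_of_cdf_linear hs h hp,
    rightQuantile_eq_of_cdf_linear hs h hp]

lemma median_eq_of_cdf_linear (hs : 0 < s) (hw : 0 < w)
    (h : ∀ x ∈ Set.Icc (m - w) (m + w), cdf F x = 1 / 2 + s * (x - m)) :
    median F = m := by
  have hp : |(1 / 2 : ℝ) - 1 / 2| < s * w := by rw [sub_self, abs_zero]; positivity
  rw [median, leftQuantile_eq_of_cdf_linear hs h hp]
  simp

variable [IsProbabilityMeasure F]

/-- If the cdf is linear without atoms in a window about the median that carries more than half of
the mass, then so is the cdf of the absolute deviation. -/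
lemma cdf_absDeviation_of_cdf_linear (hs : 0 < s) (hw : 0 < w)
    (h : ∀ x ∈ Set.Icc (m - w) (m + w), cdf F x = 1 / 2 + s * (x - m))
    (hatom : ∀ x ∈ Set.Icc (m - w) (m + w), F {x} = 0) {r : ℝ} (hr : r ∈ Set.Icc 0 w) :
    cdf (absDeviation F) r = 2 * s * r := by
  have hmeas : Measurable (fun x : ℝ => |x - median F|) := by fun_prop
  have : IsProbabilityMeasure (absDeviation F) :=
    Measure.isProbabilityMeasure_map hmeas.aemeasurable
  have hl : m - r ∈ Set.Icc (m - w) (m + w) := ⟨by linarith [hr.2], by linarith [hr.1, hr.2]⟩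
  have hu : m + r ∈ Set.Icc (m - w) (m + w) := ⟨by linarith [hr.1, hr.2], by linarith [hr.2]⟩
  have hpre : (fun x : ℝ => |x - median F|) ⁻¹' Set.Iic r = Set.Icc (m - r) (m + r) := by
    ext x
    simp only [Set.mem_preimage, Set.mem_Iic, median_eq_of_cdf_linear hs hw h, abs_le, Set.mem_Icc]
    constructor <;> rintro ⟨h1, h2⟩ <;> constructor <;> linarith
  have hIcc : F.real (Set.Iic (m + r)) = F.real (Set.Icc (m - r) (m + r)) +
      F.real (Set.Iic (m - r)) := by
    -- A difference of cdf values misses the left endpoint, which carries no mass.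
    have hae : (Set.Ioc (m - r) (m + r) : Set ℝ) =ᵐ[F] Set.Icc (m - r) (m + r) :=
      Ioc_ae_eq_Icc' (hatom _ hl)
    rw [← measureReal_congr hae, add_comm (F.real (Set.Ioc _ _)),
      ← measureReal_union _ measurableSet_Ioc,
      Set.Iic_union_Ioc_eq_Iic (by linarith [hr.1])]
    exact Set.Iic_disjoint_Ioc le_rfl
  rw [cdf_eq_real, measureReal_def, absDeviation, Measure.map_apply hmeas measurableSet_Iic,
    hpre, ← measureReal_def]
  have h1 := h _ hl
  have h2 := h _ hu
  rw [cdf_eq_real] at h1 h2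
  linarith

/-- The absolute deviation has cdf `2 s r`, which reaches 1/2 at `1 / (4 s)`. The strict inequality
in `hw` leaves room on both sides of this point, so the quantile lemmas apply again to the
deviation. -/
lemma absDeviation_window (hs : 0 < s) (hw : 1 / (4 * s) < w)
    (h : ∀ x ∈ Set.Icc (m - w) (m + w), cdf F x = 1 / 2 + s * (x - m))
    (hatom : ∀ x ∈ Set.Icc (m - w) (m + w), F {x} = 0) :
    ∃ v, 0 < v ∧ ∀ r ∈ Set.Icc (1 / (4 * s) - v) (1 / (4 * s) + v),
      cdf (absDeviation F) r = 1 / 2 + 2 * s * (r - 1 / (4 * s)) := by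
  have h4 : 0 < 1 / (4 * s) := by positivity
  refine ⟨min (1 / (4 * s)) (w - 1 / (4 * s)), lt_min h4 (by linarith), fun r hr => ?_⟩
  have h1 := min_le_left (1 / (4 * s)) (w - 1 / (4 * s))
  have h2 := min_le_right (1 / (4 * s)) (w - 1 / (4 * s))
  rw [cdf_absDeviation_of_cdf_linear hs (h4.trans hw) h hatom
    ⟨by linarith [hr.1], by linarith [hr.2]⟩]
  field_simp
  ring

lemma mad_eq_of_cdf_linear (hs : 0 < s) (hw : 1 / (4 * s) < w)
    (h : ∀ x ∈ Set.Icc (m - w) (m + w), cdf F x = 1 / 2 + s * (x - m))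
    (hatom : ∀ x ∈ Set.Icc (m - w) (m + w), F {x} = 0) : mad F = 1 / (4 * s) := by
  obtain ⟨v, hv, hc⟩ := absDeviation_window hs hw h hatom
  exact median_eq_of_cdf_linear (by positivity) hv hc

/-- The value 4 is the one for which `1 / (B * mad F)` equals the slope `s`, so the growth condition
is an equality. -/
lemma inFamily_of_cdf_linear (hs : 0 < s) (hw : 1 / (4 * s) < w)
    (h : ∀ x ∈ Set.Icc (m - w) (m + w), cdf F x = 1 / 2 + s * (x - m))
    (hatom : ∀ x ∈ Set.Icc (m - w) (m + w), F {x} = 0) {t : ℝ} (ht : t ∈ Set.Ioo 0 (1 / 4)) :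
    InFamily t 4 F := by
  have hmad := mad_eq_of_cdf_linear hs hw h hatom
  have h4 : 0 < 1 / (4 * s) := by positivity
  have hw0 := h4.trans hw
  have hsw : 1 / 4 < s * w := by
    rw [div_lt_iff₀ (by positivity)] at hw ⊢
    linarith
  obtain ⟨v, hv, hc⟩ := absDeviation_window hs hw h hatom
  refine ⟨hasUniqueMedian_of_cdf_linear hs hw0 h,
    hasUniqueMedian_of_cdf_linear (by positivity) hv hc, hmad ▸ h4, ?_⟩
  have hts : t / s < w := by rw [div_lt_iff₀ hs]; linarith [ht.2]
  have e1 : (1 / 2 - t - 1 / 2) / s = -(t / s) := by ring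
  have e2 : (1 / 2 + t - 1 / 2) / s = t / s := by ring
  rw [leftQuantile_eq_of_cdf_linear hs h
      (by rw [abs_lt]; constructor <;> linarith [ht.1, ht.2]),
    rightQuantile_eq_of_cdf_linear hs h
      (by rw [abs_lt]; constructor <;> linarith [ht.1, ht.2]), e1, e2]
  intro x₁ h₁ x₂ h₂
  rw [h x₁ ⟨by linarith [h₁.1], by linarith [h₁.2]⟩,
    h x₂ ⟨by linarith [h₂.1], by linarith [h₂.2]⟩, hmad]
  have e3 : 1 / 2 + s * (x₁ - m) - (1 / 2 + s * (x₂ - m)) = s * (x₁ - x₂) := by ring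
  have e4 : 1 / (4 * (1 / (4 * s))) = s := by field_simp
  rw [e3, abs_mul, abs_of_pos hs, e4]

end Quantiles

/-! ### The true laws: two atoms and a uniform part -/

/-- Atoms of mass `a` at `-4` and `b` at `4`, and density `u` on `[-11/3, 11/3]`. -/
def threePart (a b u : ℝ) : Measure ℝ :=
  ENNReal.ofReal a • Measure.dirac (-4) + ENNReal.ofReal b • Measure.dirac 4 +
    ENNReal.ofReal u • volume.restrict (Set.Icc (-(11 / 3)) (11 / 3))

lemma threePart_apply {a b u : ℝ} (S : Set ℝ) :
    threePart a b u S = ENNReal.ofReal a * Measure.dirac (-4 : ℝ) S +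
      ENNReal.ofReal b * Measure.dirac (4 : ℝ) S +
      ENNReal.ofReal u * volume.restrict (Set.Icc (-(11 / 3) : ℝ) (11 / 3)) S := rfl

lemma isProbabilityMeasure_threePart {a b u : ℝ} (ha : 0 ≤ a) (hb : 0 ≤ b) (hu : 0 ≤ u)
    (h : a + b + u * (22 / 3) = 1) : IsProbabilityMeasure (threePart a b u) := by
  constructor
  rw [threePart_apply, Measure.restrict_apply_univ, Real.volume_Icc, measure_univ, measure_univ,
    mul_one, mul_one, ← ENNReal.ofReal_mul hu, ← ENNReal.ofReal_add ha hb,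
    ← ENNReal.ofReal_add (by positivity) (by positivity), ← ENNReal.ofReal_one]
  congr 1
  linarith

instance {a b u : ℝ} : IsFiniteMeasure (threePart a b u) := by
  constructor
  rw [threePart_apply, Measure.restrict_apply_univ, Real.volume_Icc, measure_univ, measure_univ,
    mul_one, mul_one, ← ENNReal.ofReal_mul' (by norm_num)]
  finiteness

lemma threePart_Iic {a b u : ℝ} (ha : 0 ≤ a) (hu : 0 ≤ u) {x : ℝ}
    (hx : x ∈ Set.Icc (-(11 / 3) : ℝ) (11 / 3)) :
    (threePart a b u).real (Set.Iic x) = a + u * (x + 11 / 3) := by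
  have h1 : (-4 : ℝ) ∈ Set.Iic x := by rw [Set.mem_Iic]; linarith [hx.1]
  have h2 : (4 : ℝ) ∉ Set.Iic x := by rw [Set.mem_Iic]; linarith [hx.2]
  have h3 : Set.Iic x ∩ Set.Icc (-(11 / 3) : ℝ) (11 / 3) = Set.Icc (-(11 / 3)) x := by
    ext y
    simp only [Set.mem_inter_iff, Set.mem_Iic, Set.mem_Icc]
    exact ⟨fun h => ⟨h.2.1, h.1⟩, fun h => ⟨h.2, h.1, h.2.trans hx.2⟩⟩
  have h4 : 0 ≤ x - -(11 / 3) := by linarith [hx.1]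
  rw [measureReal_def, threePart_apply, Measure.dirac_apply_of_mem h1,
    Measure.dirac_apply' _ measurableSet_Iic, Set.indicator_of_notMem h2,
    Measure.restrict_apply measurableSet_Iic, h3, Real.volume_Icc, mul_one, mul_zero, add_zero,
    ← ENNReal.ofReal_mul hu, ← ENNReal.ofReal_add ha (by positivity),
    ENNReal.toReal_ofReal (by positivity)]
  ring

lemma threePart_singleton {a b u : ℝ} {x : ℝ}
    (hx : x ∈ Set.Icc (-(11 / 3) : ℝ) (11 / 3)) : threePart a b u {x} = 0 := by
  have h1 : (-4 : ℝ) ∉ ({x} : Set ℝ) := by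
    rw [Set.mem_singleton_iff]; rintro rfl; linarith [hx.1]
  have h2 : (4 : ℝ) ∉ ({x} : Set ℝ) := by
    rw [Set.mem_singleton_iff]; rintro rfl; linarith [hx.2]
  have h3 : volume.restrict (Set.Icc (-(11 / 3) : ℝ) (11 / 3)) {x} = 0 :=
    le_antisymm ((Measure.restrict_apply_le _ _).trans (by simp)) zero_le
  rw [threePart_apply, Measure.dirac_apply' _ (measurableSet_singleton x),
    Measure.dirac_apply' _ (measurableSet_singleton x), Set.indicator_of_notMem h1,
    Set.indicator_of_notMem h2, h3]
  simp

lemma lintegral_threePart {a b u : ℝ} (f : ℝ → ENNReal) :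
    ∫⁻ x, f x ∂threePart a b u = ENNReal.ofReal a * f (-4) + ENNReal.ofReal b * f 4 +
      ENNReal.ofReal u * ∫⁻ x in Set.Icc (-(11 / 3)) (11 / 3), f x := by
  rw [threePart, lintegral_add_measure, lintegral_add_measure, lintegral_smul_measure,
    lintegral_smul_measure, lintegral_smul_measure, lintegral_dirac, lintegral_dirac]
  simp only [smul_eq_mul]

/-- A true distribution with median `m`. -/
def trueLaw (m : ℝ) : Measure ℝ := threePart (2 / 15 - m / 10) (2 / 15 + m / 10) (1 / 10)

lemma isProbabilityMeasure_trueLaw {m : ℝ} (hm : |m| ≤ 1) : IsProbabilityMeasure (trueLaw m) := by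
  obtain ⟨h1, h2⟩ := abs_le.1 hm
  exact isProbabilityMeasure_threePart (by linarith) (by linarith) (by norm_num) (by ring)

/-- The half-width 13/5 exceeds the deviation 5/2, as `mad_eq_of_cdf_linear` requires, and `1 + 13/5
≤ 11/3` keeps the window inside the uniform part. -/
lemma cdf_trueLaw {m : ℝ} (hm : |m| ≤ 1) {x : ℝ}
    (hx : x ∈ Set.Icc (m - 13 / 5) (m + 13 / 5)) :
    cdf (trueLaw m) x = 1 / 2 + 1 / 10 * (x - m) := by
  obtain ⟨h1, h2⟩ := abs_le.1 hm
  have := isProbabilityMeasure_trueLaw hm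
  rw [cdf_eq_real, trueLaw, threePart_Iic (by linarith) (by norm_num)
    ⟨by linarith [hx.1], by linarith [hx.2]⟩]
  ring

lemma trueLaw_singleton {m : ℝ} (hm : |m| ≤ 1) {x : ℝ}
    (hx : x ∈ Set.Icc (m - 13 / 5) (m + 13 / 5)) : trueLaw m {x} = 0 := by
  obtain ⟨h1, h2⟩ := abs_le.1 hm
  exact threePart_singleton ⟨by linarith [hx.1], by linarith [hx.2]⟩

lemma median_trueLaw {m : ℝ} (hm : |m| ≤ 1) : median (trueLaw m) = m :=
  median_eq_of_cdf_linear (by norm_num) (by norm_num) (fun _ hx => cdf_trueLaw hm hx)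

lemma mad_trueLaw {m : ℝ} (hm : |m| ≤ 1) : mad (trueLaw m) = 5 / 2 := by
  have := isProbabilityMeasure_trueLaw hm
  rw [mad_eq_of_cdf_linear (by norm_num) (by norm_num) (fun _ hx => cdf_trueLaw hm hx)
    (fun _ hx => trueLaw_singleton hm hx)]
  norm_num

lemma inFamily_trueLaw {m t : ℝ} (hm : |m| ≤ 1) (ht : t ∈ Set.Ioo 0 (1 / 4)) :
    InFamily t 4 (trueLaw m) := by
  have := isProbabilityMeasure_trueLaw hm
  exact inFamily_of_cdf_linear (by norm_num) (by norm_num) (fun _ hx => cdf_trueLaw hm hx)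
    (fun _ hx => trueLaw_singleton hm hx) ht

/-! ### The observed laws and their divergence -/

/-- The law of the samples of an arm whose observed median is `θ`; the parameter `η` is the
contamination level, or zero for a malicious adversary. -/
def obsLaw (η θ : ℝ) : Measure ℝ :=
  threePart ((1 - η) * (2 / 15 - θ / 10) + η / 2) ((1 - η) * (2 / 15 + θ / 10) + η / 2)
    ((1 - η) / 10)

/-- Atoms bounded away from zero make the likelihood ratios positive and give a divergence bound
uniform in all parameters. -/
lemma obsLaw_weights {η θ : ℝ} (hη : η ∈ Set.Ico 0 1) (hθ : |θ| ≤ 1 / 3) :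
    1 / 10 ≤ (1 - η) * (2 / 15 - θ / 10) + η / 2 ∧
      1 / 10 ≤ (1 - η) * (2 / 15 + θ / 10) + η / 2 := by
  obtain ⟨h1, h2⟩ := abs_le.1 hθ
  obtain ⟨h3, h4⟩ := hη
  constructor <;> nlinarith

/-- The function that is `p` at `-4`, `q` at `4` and `1` elsewhere. -/
def threeValued (p q x : ℝ) : ℝ := if x = -4 then p else if x = 4 then q else 1

lemma measurable_threeValued (p q : ℝ) : Measurable (threeValued p q) :=
  Measurable.ite (measurableSet_singleton _) measurable_const
    (Measurable.ite (measurableSet_singleton _) measurable_const measurable_const)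

lemma threeValued_eq_one {p q x : ℝ} (hx : x ∈ Set.Icc (-(11 / 3) : ℝ) (11 / 3)) :
    threeValued p q x = 1 := by
  rw [threeValued, if_neg, if_neg]
  · rintro rfl; linarith [hx.2]
  · rintro rfl; linarith [hx.1]

/-- The density of `obsLaw η θ'` with respect to `obsLaw η θ`. -/
def obsDensity (η θ θ' : ℝ) : ℝ → ℝ :=
  threeValued
    (((1 - η) * (2 / 15 - θ' / 10) + η / 2) / ((1 - η) * (2 / 15 - θ / 10) + η / 2))
    (((1 - η) * (2 / 15 + θ' / 10) + η / 2) / ((1 - η) * (2 / 15 + θ / 10) + η / 2))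

lemma measurable_obsDensity (η θ θ' : ℝ) : Measurable (obsDensity η θ θ') :=
  measurable_threeValued _ _

lemma obsDensity_pos {η θ θ' : ℝ} (hη : η ∈ Set.Ico 0 1) (hθ : |θ| ≤ 1 / 3) (hθ' : |θ'| ≤ 1 / 3)
    (x : ℝ) : 0 < obsDensity η θ θ' x := by
  obtain ⟨h1, h2⟩ := obsLaw_weights hη hθ
  obtain ⟨h3, h4⟩ := obsLaw_weights hη hθ'
  rw [obsDensity, threeValued]
  split_ifs
  · apply div_pos <;> linarith
  · apply div_pos <;> linarith
  · exact one_pos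

/-- Changing `θ` only transfers mass between the two atoms, so the density is 1 on the uniform part.
-/
lemma lintegral_obsLaw_change {η θ θ' : ℝ} (hη : η ∈ Set.Ico 0 1) (hθ : |θ| ≤ 1 / 3)
    (f : ℝ → ENNReal) :
    ∫⁻ x, f x * ENNReal.ofReal (obsDensity η θ θ' x) ∂obsLaw η θ = ∫⁻ x, f x ∂obsLaw η θ' := by
  obtain ⟨h1, h2⟩ := obsLaw_weights hη hθ
  rw [obsLaw, obsLaw, lintegral_threePart, lintegral_threePart]
  congr 1
  · congr 1
    · rw [obsDensity, threeValued, if_pos rfl, mul_left_comm,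
        ← ENNReal.ofReal_mul (by linarith), mul_div_cancel₀ _ (by linarith), mul_comm]
    · rw [obsDensity, threeValued, if_neg (by norm_num), if_pos rfl, mul_left_comm,
        ← ENNReal.ofReal_mul (by linarith), mul_div_cancel₀ _ (by linarith), mul_comm]
  · congr 1
    refine setLIntegral_congr_fun measurableSet_Icc fun x hx => ?_
    simp only [obsDensity]
    rw [threeValued_eq_one hx]
    simp

lemma abs_log_threeValued_le (p q x : ℝ) :
    |Real.log (threeValued p q x)| ≤ |Real.log p| + |Real.log q| := by
  rw [threeValued]
  split_ifs
  · linarith [abs_nonneg (Real.log q)]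
  · linarith [abs_nonneg (Real.log p)]
  · rw [Real.log_one, abs_zero]; positivity

lemma integrable_threeValued {a b u p q : ℝ} :
    Integrable (fun x => Real.log (threeValued p q x)) (threePart a b u) :=
  Integrable.of_bound
    ((Real.measurable_log.comp (measurable_threeValued p q)).aestronglyMeasurable)
    _ (Filter.Eventually.of_forall (abs_log_threeValued_le p q))

lemma integral_log_threeValued {a b u p q : ℝ} (ha : 0 ≤ a) (hb : 0 ≤ b) :
    ∫ x, Real.log (threeValued p q x) ∂threePart a b u = a * Real.log p + b * Real.log q := by
  have hi : Integrable (fun x => Real.log (threeValued p q x)) (threePart a b u) :=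
    integrable_threeValued
  rw [threePart] at hi ⊢
  rw [integral_add_measure hi.left_of_add_measure hi.right_of_add_measure,
    integral_add_measure hi.left_of_add_measure.left_of_add_measure
      hi.left_of_add_measure.right_of_add_measure, integral_smul_measure, integral_smul_measure,
    integral_smul_measure, integral_dirac, integral_dirac, ENNReal.toReal_ofReal ha,
    ENNReal.toReal_ofReal hb]
  have h0 : ∫ x in Set.Icc (-(11 / 3)) (11 / 3), Real.log (threeValued p q x) = 0 := by
    rw [setIntegral_congr_fun measurableSet_Icc (g := fun _ => (0 : ℝ)), integral_zero]
    intro x hx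
    simp only []
    rw [threeValued_eq_one hx, Real.log_one]
  rw [h0, smul_zero, add_zero, threeValued, if_pos rfl, threeValued, if_neg (by norm_num),
    if_pos rfl, smul_eq_mul, smul_eq_mul]

/-- The Kullback-Leibler divergence of the sample laws is at most quadratic in the shift. -/
lemma integral_log_obsDensity {η θ θ' : ℝ} (hη : η ∈ Set.Ico 0 1) (hθ : |θ| ≤ 1 / 3)
    (hθ' : |θ'| ≤ 1 / 3) :
    -∫ x, Real.log (obsDensity η θ θ' x) ∂obsLaw η θ ≤ (θ' - θ) ^ 2 / 5 := by
  obtain ⟨h1, h2⟩ := obsLaw_weights hη hθ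
  obtain ⟨h3, h4⟩ := obsLaw_weights hη hθ'
  rw [obsLaw, obsDensity, integral_log_threeValued (by linarith) (by linarith)]
  have e1 : (1 - η) * (2 / 15 - θ / 10) + η / 2 =
    ((1 - η) * (2 / 15 - θ' / 10) + η / 2) + (1 - η) * (θ' - θ) / 10 := by ring
  have e2 : (1 - η) * (2 / 15 + θ / 10) + η / 2 =
    ((1 - η) * (2 / 15 + θ' / 10) + η / 2) - (1 - η) * (θ' - θ) / 10 := by ring
  have hd : ((1 - η) * (θ' - θ) / 10) ^ 2 ≤ (θ' - θ) ^ 2 / 100 := by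
    have : (1 - η) ^ 2 ≤ 1 := by nlinarith [hη.1, hη.2]
    nlinarith [sq_nonneg (θ' - θ)]
  generalize (1 - η) * (2 / 15 - θ / 10) + η / 2 = a at *
  generalize (1 - η) * (2 / 15 + θ / 10) + η / 2 = b at *
  generalize (1 - η) * (2 / 15 - θ' / 10) + η / 2 = a' at *
  generalize (1 - η) * (2 / 15 + θ' / 10) + η / 2 = b' at *
  generalize (1 - η) * (θ' - θ) / 10 = d at *
  -- This bounds the divergence by a chi-square term. The linear parts cancel between the two atoms,
  -- since `a - a' = d` and `b - b' = -d`, which leaves `20 d² ≤ (θ' - θ)² / 5`.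
  have key : ∀ x y : ℝ, 1 / 10 ≤ x → 1 / 10 ≤ y →
      -(x * Real.log (y / x)) ≤ (x - y) + 10 * (x - y) ^ 2 := by
    intro x y hx hy
    have hx0 : 0 < x := by linarith
    have hy0 : 0 < y := by linarith
    have hl := Real.log_le_sub_one_of_pos (div_pos hx0 hy0)
    have hinv : Real.log (y / x) = -Real.log (x / y) := by
      rw [← Real.log_inv, inv_div]
    rw [hinv]
    have h5 : x * Real.log (x / y) ≤ x * (x / y - 1) := mul_le_mul_of_nonneg_left hl hx0.le
    have h6 : x * (x / y - 1) = (x - y) + (x - y) ^ 2 / y := by field_simp; ring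
    have h7 : (x - y) ^ 2 / y ≤ 10 * (x - y) ^ 2 := by
      rw [div_le_iff₀ hy0]
      nlinarith [sq_nonneg (x - y)]
    linarith
  have k1 := key a a' h1 h3
  have k2 := key b b' h2 h4
  have e3 : a - a' = d := by linarith
  have e4 : b - b' = -d := by linarith
  rw [e3] at k1
  rw [e4] at k2
  nlinarith

lemma exists_abs_log_obsDensity_le (η θ θ' : ℝ) :
    ∃ C, ∀ x, |Real.log (obsDensity η θ θ' x)| ≤ C :=
  ⟨_, abs_log_threeValued_le _ _⟩

/-! ### Triples independent over arms and rounds -/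

section TriplesLaw

variable {k : ℕ} (τ : Fin k → Measure (ℝ × Bool × ℝ)) [∀ i, IsProbabilityMeasure (τ i)]

/-- The law of triples that are independent over arms and rounds, the triples of arm `i` having
the law `τ i`. -/
def triplesLaw : Measure (Triples k) :=
  (Measure.infinitePi fun _ : ℕ => Measure.pi τ).map fun f i t => f t i

lemma measurable_triplesSwap :
    Measurable (fun (f : ℕ → Fin k → ℝ × Bool × ℝ) (i : Fin k) (t : ℕ) => f t i) := by
  fun_prop

instance : IsProbabilityMeasure (triplesLaw τ) :=
  Measure.isProbabilityMeasure_map measurable_triplesSwap.aemeasurable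

lemma triplesLaw_map_round (t : ℕ) :
    (triplesLaw τ).map (fun e i => e i t) = Measure.pi τ := by
  rw [triplesLaw, Measure.map_map (by fun_prop) measurable_triplesSwap]
  exact Measure.infinitePi_map_eval (fun _ : ℕ => Measure.pi τ) t

lemma triplesLaw_map_eval (i : Fin k) (t : ℕ) :
    (triplesLaw τ).map (fun e => e i t) = τ i := by
  rw [← (measurePreserving_eval τ i).map_eq, ← triplesLaw_map_round τ t,
    Measure.map_map (by fun_prop) (by fun_prop)]
  rfl

lemma iIndepFun_triplesLaw_rounds :
    iIndepFun (fun (t : ℕ) (e : Triples k) (i : Fin k) => e i t) (triplesLaw τ) := by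
  rw [iIndepFun_iff_map_fun_eq_infinitePi_map (fun t => by fun_prop)]
  simp_rw [triplesLaw_map_round]
  rw [triplesLaw, Measure.map_map (by fun_prop) measurable_triplesSwap]
  exact Measure.map_id

lemma iIndepFun_triplesLaw (i : Fin k) :
    iIndepFun (fun (t : ℕ) (e : Triples k) => e i t) (triplesLaw τ) :=
  (iIndepFun_triplesLaw_rounds τ).comp (fun _ f => f i) (fun _ => measurable_pi_apply i)

lemma indepFun_triplesLaw_past (n : ℕ) :
    IndepFun (fun (e : Triples k) (t : Finset.range n) (i : Fin k) => e i t)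
      (fun (e : Triples k) (i : Fin k) => e i n) (triplesLaw τ) := by
  have h := (iIndepFun_triplesLaw_rounds τ).indepFun_finset (Finset.range n) {n} (by simp)
    (fun t => by fun_prop)
  exact h.comp (φ := id) (ψ := fun (f : ({n} : Finset ℕ) → Fin k → ℝ × Bool × ℝ) =>
    f ⟨n, Finset.mem_singleton_self n⟩) measurable_id (measurable_pi_apply _)

lemma indepFun_triplesLaw_eval {β γ : Type*} [MeasurableSpace β] [MeasurableSpace γ]
    {f : ℝ × Bool × ℝ → β} {g : ℝ × Bool × ℝ → γ} (hf : Measurable f) (hg : Measurable g)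
    (i : Fin k) (t : ℕ) (h : IndepFun f g (τ i)) :
    IndepFun (fun e : Triples k => f (e i t)) (fun e : Triples k => g (e i t))
      (triplesLaw τ) := by
  rw [indepFun_iff_map_prod_eq_prod_map_map hf.aemeasurable hg.aemeasurable,
    ← triplesLaw_map_eval τ i t, Measure.map_map (by fun_prop) (by fun_prop),
    Measure.map_map (by fun_prop) (by fun_prop),
    Measure.map_map (by fun_prop) (by fun_prop)] at h
  have he : Measurable (fun e : Triples k => e i t) := by fun_prop
  exact (indepFun_iff_map_prod_eq_prod_map_map (hf.comp he).aemeasurable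
    (hg.comp he).aemeasurable).2 h

/-- The contaminated sample of one triple. -/
def mix (p : ℝ × Bool × ℝ) : ℝ := if p.2.1 = true then p.2.2 else p.1

lemma measurable_mix : Measurable mix :=
  Measurable.ite ((measurableSet_singleton true).preimage (measurable_fst.comp measurable_snd))
    (measurable_snd.comp measurable_snd) measurable_fst

lemma triplesLaw_map_sample (i : Fin k) (t : ℕ) :
    (triplesLaw τ).map (fun e => sample e i t) = (τ i).map mix := by
  rw [← triplesLaw_map_eval τ i t, Measure.map_map measurable_mix (by fun_prop)]
  rfl

/-- The instance with triples that are independent over arms and rounds. -/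
def productInstance : Instance k where
  dist i := ⟨(τ i).map Prod.fst, Measure.isProbabilityMeasure_map measurable_fst.aemeasurable⟩
  law := ⟨triplesLaw τ, inferInstance⟩

/-- Whole triples are independent over rounds, which is the oblivious requirement, so one
construction serves all adversaries. Only the dependence of `Y` and `D` within a triple varies with
the type. -/
lemma admissible_productInstance {adv : Adversary} {ε : ℝ}
    (hD : ∀ i, τ i {p | p.2.1 = true} = ENNReal.ofReal ε)
    (hYD : adv ≠ .malicious → ∀ i,
      IndepFun (Prod.fst : ℝ × Bool × ℝ → ℝ) (fun p => p.2.1) (τ i)) :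
    (productInstance τ).Admissible adv ε where
  law_Y i t := by
    change (triplesLaw τ).map _ = (τ i).map Prod.fst
    rw [← triplesLaw_map_eval τ i t, Measure.map_map measurable_fst (by fun_prop)]
    rfl
  law_D i t := by
    change triplesLaw τ _ = _
    rw [← hD i, ← triplesLaw_map_eval τ i t, Measure.map_apply (by fun_prop)]
    · rfl
    · exact (measurableSet_singleton true).preimage (measurable_fst.comp measurable_snd)
  indep_pairs i := (iIndepFun_triplesLaw τ i).comp (fun _ p => (p.1, p.2.1))
    (fun _ => by fun_prop)
  indep_Y_D h i t := indepFun_triplesLaw_eval τ (by fun_prop) (by fun_prop) i t (hYD h i)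
  indep_triples _ i := iIndepFun_triplesLaw τ i

end TriplesLaw

/-! ### Two ways of contaminating one sample -/

/-- The law of one triple under an adversary that flips an independent coin and puts the
contaminated samples at `z`. -/
def independentTriple (ε m z : ℝ) : Measure (ℝ × Bool × ℝ) :=
  (trueLaw m).prod ((ENNReal.ofReal (1 - ε) • Measure.dirac false +
    ENNReal.ofReal ε • Measure.dirac true).prod (Measure.dirac z))

/-- The law of one triple under an adversary that moves a mass `ε` from the atom at `4` to the atom
at `-4` (or the other way round if `up`). -/
def movingTriple (ε m : ℝ) (up : Bool) : Measure (ℝ × Bool × ℝ) :=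
  if up then
    ENNReal.ofReal ε • Measure.dirac (-4, true, 4) +
      (threePart (2 / 15 - m / 10 - ε) (2 / 15 + m / 10) (1 / 10)).map fun y => (y, false, 0)
  else
    ENNReal.ofReal ε • Measure.dirac (4, true, -4) +
      (threePart (2 / 15 - m / 10) (2 / 15 + m / 10 - ε) (1 / 10)).map fun y => (y, false, 0)

section OneTriple

variable {ε m : ℝ}

lemma isProbabilityMeasure_coin (hε : ε ∈ Set.Icc 0 1) :
    IsProbabilityMeasure (ENNReal.ofReal (1 - ε) • Measure.dirac false +
      ENNReal.ofReal ε • Measure.dirac true) := by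
  constructor
  rw [Measure.add_apply, Measure.smul_apply, Measure.smul_apply, measure_univ, measure_univ,
    smul_eq_mul, smul_eq_mul, mul_one, mul_one,
    ← ENNReal.ofReal_add (by linarith [hε.2]) hε.1, sub_add_cancel, ENNReal.ofReal_one]

lemma isProbabilityMeasure_independentTriple (hε : ε ∈ Set.Icc 0 1) (hm : |m| ≤ 1) (z : ℝ) :
    IsProbabilityMeasure (independentTriple ε m z) := by
  have := isProbabilityMeasure_coin hε
  have := isProbabilityMeasure_trueLaw hm
  unfold independentTriple
  infer_instance

lemma independentTriple_map_fst (hε : ε ∈ Set.Icc 0 1) (z : ℝ) :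
    (independentTriple ε m z).map Prod.fst = trueLaw m := by
  have := isProbabilityMeasure_coin hε
  rw [independentTriple, Measure.map_fst_prod, measure_univ, one_smul]

lemma independentTriple_contaminated (hε : ε ∈ Set.Icc 0 1) (hm : |m| ≤ 1) (z : ℝ) :
    independentTriple ε m z {p | p.2.1 = true} = ENNReal.ofReal ε := by
  have := isProbabilityMeasure_coin hε
  have := isProbabilityMeasure_trueLaw hm
  have : {p : ℝ × Bool × ℝ | p.2.1 = true} = Set.univ ×ˢ ({true} ×ˢ Set.univ) := by
    ext p; simp
  rw [this, independentTriple, Measure.prod_prod, Measure.prod_prod, measure_univ, measure_univ]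
  simp

lemma independentTriple_indep (hε : ε ∈ Set.Icc 0 1) (hm : |m| ≤ 1) (z : ℝ) :
    IndepFun (Prod.fst : ℝ × Bool × ℝ → ℝ) (fun p => p.2.1) (independentTriple ε m z) := by
  have := isProbabilityMeasure_coin hε
  have := isProbabilityMeasure_trueLaw hm
  exact indepFun_prod (X := id) (Y := Prod.fst) measurable_id measurable_fst

lemma lintegral_independentTriple (z : ℝ) {f : ℝ × Bool × ℝ → ENNReal} (hf : Measurable f) :
    ∫⁻ p, f p ∂independentTriple ε m z = ∫⁻ y, (ENNReal.ofReal (1 - ε) * f (y, false, z) +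
      ENNReal.ofReal ε * f (y, true, z)) ∂trueLaw m := by
  have : SFinite (trueLaw m) := by unfold trueLaw; infer_instance
  rw [independentTriple, lintegral_prod _ hf.aemeasurable]
  refine lintegral_congr fun y => ?_
  rw [lintegral_prod _ (by fun_prop), lintegral_add_measure, lintegral_smul_measure,
    lintegral_smul_measure, lintegral_dirac, lintegral_dirac, lintegral_dirac, lintegral_dirac]
  rfl

/-- Both laws have the same uniform part, so only the atoms need to agree. Contamination at one atom
puts all of `ε` there, while `obsLaw` splits it evenly; the shift of the median compensates when `(1
- ε) |m - θ| / 10 = ε / 2`. -/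
lemma independentTriple_map_mix (hε : ε ∈ Set.Icc 0 1) (hm : |m| ≤ 1) {z θ : ℝ}
    (h : (z = -4 ∧ (1 - ε) * (m - θ) = ε * 5) ∨ (z = 4 ∧ (1 - ε) * (θ - m) = ε * 5)) :
    (independentTriple ε m z).map mix = obsLaw ε θ := by
  have := isProbabilityMeasure_trueLaw hm
  obtain ⟨h1, h2⟩ := abs_le.1 hm
  have h3 : 0 ≤ 1 - ε := by linarith [hε.2]
  have h4 := hε.1
  refine Measure.ext_of_lintegral _ fun f hf => ?_
  rw [lintegral_map hf measurable_mix,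
    lintegral_independentTriple z (f := fun p => f (mix p)) (hf.comp measurable_mix)]
  have e1 : ∀ y : ℝ, mix (y, false, z) = y := fun y => by simp [mix]
  have e2 : ∀ y : ℝ, mix (y, true, z) = z := fun y => by simp [mix]
  simp_rw [e1, e2]
  rw [lintegral_add_right _ measurable_const, lintegral_const, measure_univ, mul_one,
    lintegral_const_mul _ hf, trueLaw, obsLaw, lintegral_threePart, lintegral_threePart,
    mul_add, mul_add, ← mul_assoc, ← mul_assoc, ← mul_assoc, ← ENNReal.ofReal_mul h3,
    ← ENNReal.ofReal_mul h3, ← ENNReal.ofReal_mul h3]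
  rcases h with ⟨rfl, h⟩ | ⟨rfl, h⟩
  · have e3 : (1 - ε) * (2 / 15 - θ / 10) + ε / 2 = (1 - ε) * (2 / 15 - m / 10) + ε := by
      linarith
    have e4 : (1 - ε) * (2 / 15 + θ / 10) + ε / 2 = (1 - ε) * (2 / 15 + m / 10) := by
      linarith
    rw [e3, e4, ENNReal.ofReal_add (mul_nonneg h3 (by linarith)) h4, mul_one_div]
    ring
  · have e3 : (1 - ε) * (2 / 15 - θ / 10) + ε / 2 = (1 - ε) * (2 / 15 - m / 10) := by
      linarith
    have e4 : (1 - ε) * (2 / 15 + θ / 10) + ε / 2 = (1 - ε) * (2 / 15 + m / 10) + ε := by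
      linarith
    rw [e3, e4, ENNReal.ofReal_add (mul_nonneg h3 (by linarith)) h4, mul_one_div]
    ring

lemma lintegral_movingTriple (up : Bool) {f : ℝ × Bool × ℝ → ENNReal} (hf : Measurable f) :
    ∫⁻ p, f p ∂movingTriple ε m up = if up then
      ENNReal.ofReal ε * f (-4, true, 4) + ∫⁻ y, f (y, false, 0)
        ∂threePart (2 / 15 - m / 10 - ε) (2 / 15 + m / 10) (1 / 10)
    else ENNReal.ofReal ε * f (4, true, -4) + ∫⁻ y, f (y, false, 0)
        ∂threePart (2 / 15 - m / 10) (2 / 15 + m / 10 - ε) (1 / 10) := by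
  unfold movingTriple
  split_ifs <;>
  rw [lintegral_add_measure, lintegral_smul_measure, lintegral_dirac,
    lintegral_map hf (by fun_prop), smul_eq_mul]

lemma movingTriple_map_fst (hε : 0 ≤ ε) {up : Bool}
    (h : if up then ε ≤ 2 / 15 - m / 10 else ε ≤ 2 / 15 + m / 10) :
    (movingTriple ε m up).map Prod.fst = trueLaw m := by
  refine Measure.ext_of_lintegral _ fun f hf => ?_
  rw [lintegral_map hf measurable_fst, lintegral_movingTriple up (by fun_prop), trueLaw]
  simp_rw [lintegral_threePart]
  split_ifs at h ⊢ with hu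
  · have e : ENNReal.ofReal (2 / 15 - m / 10) =
        ENNReal.ofReal ε + ENNReal.ofReal (2 / 15 - m / 10 - ε) := by
      rw [← ENNReal.ofReal_add hε (by linarith), add_sub_cancel]
    rw [e]
    ring
  · have e : ENNReal.ofReal (2 / 15 + m / 10) =
        ENNReal.ofReal ε + ENNReal.ofReal (2 / 15 + m / 10 - ε) := by
      rw [← ENNReal.ofReal_add hε (by linarith), add_sub_cancel]
    rw [e]
    ring

/-- Moving mass `ε` across the uniform part changes the cdf there by `ε`, hence the median by `10
ε`, as the slope is 1/10. -/
lemma movingTriple_map_mix (hε : 0 ≤ ε) (hε' : ε ≤ 1 / 15) {up : Bool} {θ : ℝ} (hθ : |θ| ≤ 1 / 3)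
    (h : m = if up then θ - 10 * ε else θ + 10 * ε) :
    (movingTriple ε m up).map mix = obsLaw 0 θ := by
  obtain ⟨h1, h2⟩ := abs_le.1 hθ
  refine Measure.ext_of_lintegral _ fun f hf => ?_
  rw [lintegral_map hf measurable_mix,
    lintegral_movingTriple up (f := fun p => f (mix p)) (hf.comp measurable_mix), obsLaw]
  have e1 : ∀ y : ℝ, mix (y, false, 0) = y := fun y => by simp [mix]
  have e2 : ∀ y z : ℝ, mix (y, true, z) = z := fun y z => by simp [mix]
  simp_rw [e1, e2, lintegral_threePart]
  split_ifs at h ⊢ with hu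
  · have e3 : 2 / 15 - m / 10 - ε = (1 - 0) * (2 / 15 - θ / 10) + 0 / 2 := by linarith
    have e4 : (1 - 0) * (2 / 15 + θ / 10) + 0 / 2 = ε + (2 / 15 + m / 10) := by linarith
    rw [e3, e4, ENNReal.ofReal_add hε (by linarith), sub_zero]
    ring
  · have e3 : 2 / 15 + m / 10 - ε = (1 - 0) * (2 / 15 + θ / 10) + 0 / 2 := by linarith
    have e4 : (1 - 0) * (2 / 15 - θ / 10) + 0 / 2 = ε + (2 / 15 - m / 10) := by linarith
    rw [e3, e4, ENNReal.ofReal_add hε (by linarith), sub_zero]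
    ring

lemma isProbabilityMeasure_movingTriple (hε : 0 ≤ ε) (hm : |m| ≤ 1) {up : Bool}
    (h : if up then ε ≤ 2 / 15 - m / 10 else ε ≤ 2 / 15 + m / 10) :
    IsProbabilityMeasure (movingTriple ε m up) := by
  have := isProbabilityMeasure_trueLaw hm
  constructor
  have h1 := congrArg (fun μ => μ Set.univ) (movingTriple_map_fst hε h)
  simpa only [Measure.map_apply measurable_fst MeasurableSet.univ, Set.preimage_univ,
    measure_univ] using h1

lemma movingTriple_contaminated (up : Bool) :
    movingTriple ε m up {p | p.2.1 = true} = ENNReal.ofReal ε := by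
  have hS : MeasurableSet {p : ℝ × Bool × ℝ | p.2.1 = true} :=
    (measurableSet_singleton true).preimage (measurable_fst.comp measurable_snd)
  rw [← lintegral_indicator_one hS, lintegral_movingTriple up (measurable_one.indicator hS)]
  split_ifs <;> simp

end OneTriple

/-! ### One arm with a prescribed observed median -/

/-- The law of one triple of an arm with observed median `θ`. The true median is above `θ` if
`up`, and below `θ` otherwise. -/
def armTriple (adv : Adversary) (ε θ : ℝ) (up : Bool) : Measure (ℝ × Bool × ℝ) :=
  match adv with
  | .malicious => movingTriple ε (if up then θ + 10 * ε else θ - 10 * ε) !up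
  | _ => independentTriple ε (if up then θ + uncertainty adv ε 4 (5 / 2)
      else θ - uncertainty adv ε 4 (5 / 2)) (if up then -4 else 4)

/-- The contamination parameter of the law of the samples. -/
def obsLevel (adv : Adversary) (ε : ℝ) : ℝ :=
  match adv with
  | .malicious => 0
  | _ => ε

/-- The true median of an arm with observed median `θ`. -/
def trueMedian (adv : Adversary) (ε θ : ℝ) (up : Bool) : ℝ :=
  if up then θ + uncertainty adv ε 4 (5 / 2) else θ - uncertainty adv ε 4 (5 / 2)

section ArmTriple

variable {adv : Adversary} {ε θ : ℝ} {up : Bool}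

lemma obsLevel_mem (hε : ε ∈ Set.Ioo (0 : ℝ) (1 / 15)) : obsLevel adv ε ∈ Set.Ico (0 : ℝ) 1 := by
  cases adv <;> simp only [obsLevel] <;> constructor <;> linarith [hε.1, hε.2]

lemma uncertainty_mem (hε : ε ∈ Set.Ioo (0 : ℝ) (1 / 15)) :
    uncertainty adv ε 4 (5 / 2) ∈ Set.Ioc (0 : ℝ) (2 / 3) := by
  obtain ⟨h1, h2⟩ := hε
  have h3 : 0 < ε / (2 * (1 - ε)) := div_pos h1 (by linarith)
  have h4 : ε / (2 * (1 - ε)) ≤ 1 / 15 := by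
    rw [div_le_iff₀ (by linarith)]; linarith
  cases adv <;> simp only [uncertainty] <;> constructor <;> linarith

lemma abs_trueMedian_le (hε : ε ∈ Set.Ioo (0 : ℝ) (1 / 15)) (hθ : |θ| ≤ 1 / 3) :
    |trueMedian adv ε θ up| ≤ 1 := by
  obtain ⟨h1, h2⟩ := abs_le.1 hθ
  obtain ⟨h3, h4⟩ := uncertainty_mem (adv := adv) hε
  rw [abs_le, trueMedian]
  split_ifs <;> constructor <;> linarith

/-- The flag is negated because in `movingTriple` it is the direction in which samples are moved,
opposite to the direction from the observed to the true median. -/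
lemma armTriple_malicious : armTriple .malicious ε θ up =
    movingTriple ε (trueMedian .malicious ε θ up) !up := by
  have : (4 * (5 / 2) * ε : ℝ) = 10 * ε := by ring
  simp only [armTriple, trueMedian, uncertainty, this]

lemma armTriple_of_ne (h : adv ≠ .malicious) : armTriple adv ε θ up =
    independentTriple ε (trueMedian adv ε θ up) (if up then -4 else 4) := by
  cases adv
  · rfl
  · rfl
  · exact absurd rfl h

lemma trueMedian_malicious_mass (hθ : |θ| ≤ 1 / 3) :
    if (!up) then ε ≤ 2 / 15 - trueMedian .malicious ε θ up / 10
      else ε ≤ 2 / 15 + trueMedian .malicious ε θ up / 10 := by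
  obtain ⟨h1, h2⟩ := abs_le.1 hθ
  cases up <;> simp only [trueMedian, uncertainty, Bool.not_true, Bool.not_false, if_true,
    Bool.false_eq_true, if_false] <;> linarith

lemma isProbabilityMeasure_armTriple (hε : ε ∈ Set.Ioo (0 : ℝ) (1 / 15)) (hθ : |θ| ≤ 1 / 3) :
    IsProbabilityMeasure (armTriple adv ε θ up) := by
  by_cases h : adv = .malicious
  · subst h
    rw [armTriple_malicious]
    exact isProbabilityMeasure_movingTriple hε.1.le (abs_trueMedian_le hε hθ)
      (trueMedian_malicious_mass hθ)
  · rw [armTriple_of_ne h]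
    exact isProbabilityMeasure_independentTriple ⟨hε.1.le, by linarith [hε.2]⟩
      (abs_trueMedian_le hε hθ) _

lemma armTriple_map_fst (hε : ε ∈ Set.Ioo (0 : ℝ) (1 / 15)) (hθ : |θ| ≤ 1 / 3) :
    (armTriple adv ε θ up).map Prod.fst = trueLaw (trueMedian adv ε θ up) := by
  by_cases h : adv = .malicious
  · subst h
    rw [armTriple_malicious, movingTriple_map_fst hε.1.le (trueMedian_malicious_mass hθ)]
  · rw [armTriple_of_ne h, independentTriple_map_fst ⟨hε.1.le, by linarith [hε.2]⟩]

lemma armTriple_contaminated (hε : ε ∈ Set.Ioo (0 : ℝ) (1 / 15)) (hθ : |θ| ≤ 1 / 3) :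
    armTriple adv ε θ up {p | p.2.1 = true} = ENNReal.ofReal ε := by
  by_cases h : adv = .malicious
  · subst h
    rw [armTriple_malicious, movingTriple_contaminated]
  · rw [armTriple_of_ne h, independentTriple_contaminated ⟨hε.1.le, by linarith [hε.2]⟩
      (abs_trueMedian_le hε hθ)]

/-- The flag `up` is absent from the right-hand side: samples do not reveal on which side the true
median lies. -/
lemma armTriple_map_mix (hε : ε ∈ Set.Ioo (0 : ℝ) (1 / 15)) (hθ : |θ| ≤ 1 / 3) :
    (armTriple adv ε θ up).map mix = obsLaw (obsLevel adv ε) θ := by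
  by_cases h : adv = .malicious
  · subst h
    rw [armTriple_malicious, movingTriple_map_mix hε.1.le hε.2.le hθ]
    · rfl
    · cases up <;> simp only [trueMedian, uncertainty, Bool.not_true, Bool.not_false, if_true,
        Bool.false_eq_true, if_false] <;> ring
  · have h1 : obsLevel adv ε = ε := by
      cases adv
      · rfl
      · rfl
      · exact absurd rfl h
    have h2 : uncertainty adv ε 4 (5 / 2) = 4 * (5 / 2) * (ε / (2 * (1 - ε))) := by
      cases adv
      · rfl
      · rfl
      · exact absurd rfl h
    have h3 : (1 - ε) * (4 * (5 / 2) * (ε / (2 * (1 - ε)))) = ε * 5 := by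
      have : 1 - ε ≠ 0 := by linarith [hε.2]
      field_simp
      ring
    rw [armTriple_of_ne h, h1, independentTriple_map_mix ⟨hε.1.le, by linarith [hε.2]⟩
      (abs_trueMedian_le hε hθ)]
    rw [trueMedian, h2]
    cases up
    · right
      simpa using h3
    · left
      simpa using h3

end ArmTriple

/-! ### The hard instances -/

section HardInstance

variable {k : ℕ} {adv : Adversary} {ε : ℝ}

/-- The instance with observed medians `θ` in which the arm `b` has its true median above the
observed one, and all others have it below. -/
def hardInstance (adv : Adversary) {ε : ℝ} (hε : ε ∈ Set.Ioo (0 : ℝ) (1 / 15)) {θ : Fin k → ℝ}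
    (hθ : ∀ i, |θ i| ≤ 1 / 3) (b : Fin k) : Instance k :=
  haveI := fun i => isProbabilityMeasure_armTriple (adv := adv) (up := decide (i = b)) hε (hθ i)
  productInstance fun i => armTriple adv ε (θ i) (decide (i = b))

variable (hε : ε ∈ Set.Ioo (0 : ℝ) (1 / 15)) {θ : Fin k → ℝ} (hθ : ∀ i, |θ i| ≤ 1 / 3) (b : Fin k)

lemma hardInstance_dist (i : Fin k) : ((hardInstance adv hε hθ b).dist i : Measure ℝ) =
    trueLaw (trueMedian adv ε (θ i) (decide (i = b))) :=
  armTriple_map_fst hε (hθ i)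

lemma hardInstance_median (i : Fin k) : median ((hardInstance adv hε hθ b).dist i) =
    trueMedian adv ε (θ i) (decide (i = b)) := by
  rw [hardInstance_dist, median_trueLaw (abs_trueMedian_le hε (hθ i))]

lemma hardInstance_mad (i : Fin k) : mad ((hardInstance adv hε hθ b).dist i) = 5 / 2 := by
  rw [hardInstance_dist, mad_trueLaw (abs_trueMedian_le hε (hθ i))]

/-- The displacements chosen by the adversary cancel both uncertainty terms exactly. -/
lemma hardInstance_effectiveGap {i : Fin k} (hi : i ≠ b) :
    (hardInstance adv hε hθ b).effectiveGap adv ε 4 b i = θ b - θ i := by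
  rw [Instance.effectiveGap, hardInstance_median, hardInstance_median, hardInstance_mad,
    hardInstance_mad, trueMedian, trueMedian, decide_eq_true rfl, decide_eq_false hi]
  simp

lemma hardInstance_inClass {t : ℝ} (ht : t ∈ Set.Ioo (0 : ℝ) (1 / 10))
    (hb : ∀ i, i ≠ b → θ i < θ b) :
    (hardInstance adv hε hθ b).InClass adv ε t 4 (5 / 2) b where
  admissible := by
    have := fun i => isProbabilityMeasure_armTriple (adv := adv) (up := decide (i = b)) hε (hθ i)
    refine admissible_productInstance _ (fun i => armTriple_contaminated hε (hθ i)) ?_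
    intro h i
    rw [armTriple_of_ne h]
    exact independentTriple_indep ⟨hε.1.le, by linarith [hε.2]⟩ (abs_trueMedian_le hε (hθ i)) _
  family i := by
    rw [hardInstance_dist]
    exact inFamily_trueLaw (abs_trueMedian_le hε (hθ i)) ⟨ht.1, by linarith [ht.2]⟩
  mad_le i := (hardInstance_mad hε hθ b i).le
  best i := by
    rw [hardInstance_median, hardInstance_median]
    by_cases h : i = b
    · rw [h]
    · have h1 := (uncertainty_mem (adv := adv) hε).1
      rw [trueMedian, trueMedian, decide_eq_true rfl, decide_eq_false h]
      simp only [if_true, Bool.false_eq_true, if_false]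
      linarith [hb i h]
  gap_pos i hi := by
    rw [hardInstance_effectiveGap hε hθ b hi]
    linarith [hb i hi]

end HardInstance

/-! ### The law of the next sample given the past -/

namespace Algorithm

variable {k : ℕ} (A : Algorithm k)

lemma measurable_sample (i : Fin k) (t : ℕ) : Measurable (fun e : Triples k => sample e i t) :=
  measurable_mix.comp (by fun_prop)

/-- The seed and the first `n` samples. -/
def state (n : ℕ) (p : A.Seed × Triples k) : A.Seed × (Fin n → ℝ) := (p.1, A.history p.1 p.2 n)

/-- The arm chosen in round `n`. -/
def arm (n : ℕ) (p : A.Seed × Triples k) : Fin k := A.pull n (A.state n p)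

/-- The sample received in round `n`. -/
def next (n : ℕ) (p : A.Seed × Triples k) : ℝ := sample p.2 (A.arm n p) n

lemma measurable_next_of_state {n : ℕ} (h : Measurable (A.state n)) : Measurable (A.next n) := by
  have h1 : Measurable (fun q : Triples k × Fin k => sample q.1 q.2 n) :=
    measurable_from_prod_countable_left fun i => measurable_sample i n
  exact h1.comp (measurable_snd.prodMk ((A.measurable_pull n).comp h))

lemma state_succ (n : ℕ) (p : A.Seed × Triples k) :
    A.state (n + 1) p = (p.1, Fin.snoc (α := fun _ => ℝ) (A.state n p).2 (A.next n p)) := rfl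

lemma measurable_snoc (n : ℕ) :
    Measurable (fun q : (A.Seed × (Fin n → ℝ)) × ℝ =>
      ((q.1.1, Fin.snoc (α := fun _ => ℝ) q.1.2 q.2) : A.Seed × (Fin (n + 1) → ℝ))) := by
  refine (measurable_fst.comp measurable_fst).prodMk (measurable_pi_iff.2 fun i => ?_)
  refine Fin.lastCases ?_ (fun i => ?_) i
  · simpa only [Fin.snoc_last] using measurable_snd
  · simp only [Fin.snoc_castSucc]
    fun_prop

lemma measurable_state (n : ℕ) : Measurable (A.state n) := by
  induction n with
  | zero => exact measurable_fst.prodMk measurable_const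
  | succ n ih => exact (A.measurable_snoc n).comp (ih.prodMk (A.measurable_next_of_state ih))

lemma measurable_next (n : ℕ) : Measurable (A.next n) :=
  A.measurable_next_of_state (A.measurable_state n)

lemma measurable_arm (n : ℕ) : Measurable (A.arm n) :=
  (A.measurable_pull n).comp (A.measurable_state n)

lemma history_congr (s : A.Seed) {e e' : Triples k} {n : ℕ}
    (h : ∀ t < n, ∀ i, e i t = e' i t) : A.history s e n = A.history s e' n := by
  induction n with
  | zero => rfl
  | succ n ih =>
    have hn := ih fun t ht => h t (by omega)
    simp only [history, hn]
    rw [sample, sample, h n (by omega)]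

/-- Triples with a prescribed past. -/
def extendPast (n : ℕ) (q : Finset.range n → Fin k → ℝ × Bool × ℝ) : Triples k :=
  fun i t => if h : t ∈ Finset.range n then q ⟨t, h⟩ i else (0, false, 0)

lemma measurable_extendPast (n : ℕ) : Measurable (extendPast (k := k) n) := by
  refine measurable_pi_iff.2 fun i => measurable_pi_iff.2 fun t => ?_
  unfold extendPast
  split_ifs <;> fun_prop

/-- For a fixed seed the history is a function of earlier rounds only. `extendPast` makes this
explicit by filling later rounds with irrelevant values. -/
lemma indepFun_history_sample (τ : Fin k → Measure (ℝ × Bool × ℝ))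
    [∀ i, IsProbabilityMeasure (τ i)] (s : A.Seed) (n : ℕ) (j : Fin k) :
    IndepFun (fun e => A.history s e n) (fun e => sample e j n) (triplesLaw τ) := by
  have h1 : Measurable (fun q => A.history s (extendPast n q) n) :=
    measurable_snd.comp ((A.measurable_state n).comp
      (measurable_const.prodMk (measurable_extendPast n)))
  have h2 : Measurable (fun f : Fin k → ℝ × Bool × ℝ => mix (f j)) :=
    measurable_mix.comp (measurable_pi_apply j)
  convert! (indepFun_triplesLaw_past τ n).comp h1 h2 using 1
  ext1 e
  refine A.history_congr s fun t ht i => ?_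
  rw [extendPast, dif_pos (Finset.mem_range.2 ht)]

section OneStep

variable (τ : Fin k → Measure (ℝ × Bool × ℝ)) [∀ i, IsProbabilityMeasure (τ i)]

instance (ν : Instance k) : IsProbabilityMeasure (A.jointLaw ν) := by
  unfold jointLaw; infer_instance

instance (i : Fin k) : IsProbabilityMeasure ((τ i).map mix) :=
  Measure.isProbabilityMeasure_map measurable_mix.aemeasurable

/-- The conditional law of the sample of round `n` given the past. -/
def nextKernel (n : ℕ) : Kernel (A.Seed × (Fin n → ℝ)) ℝ :=
  (Kernel.ofFunOfCountable fun i => (τ i).map mix).comap (A.pull n) (A.measurable_pull n)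

instance (n : ℕ) : IsMarkovKernel (A.nextKernel τ n) :=
  ⟨fun q => inferInstanceAs (IsProbabilityMeasure ((τ (A.pull n q)).map mix))⟩

lemma map_state_next (n : ℕ) :
    (A.jointLaw (productInstance τ)).map (fun p => (A.state n p, A.next n p)) =
      ((A.jointLaw (productInstance τ)).map (A.state n)) ⊗ₘ A.nextKernel τ n := by
  classical
  refine Measure.ext_of_lintegral _ fun f hf => ?_
  have hst := A.measurable_state n
  have hinner : Measurable fun q => ∫⁻ x, f (q, x) ∂(A.nextKernel τ n q) :=
    hf.lintegral_kernel_prod_right'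
  rw [Measure.lintegral_compProd hf, lintegral_map hf (hst.prodMk (A.measurable_next n)),
    lintegral_map hinner hst, jointLaw,
    lintegral_prod (fun p => f (A.state n p, A.next n p))
      (hf.comp (hst.prodMk (A.measurable_next n))).aemeasurable,
    lintegral_prod (fun p => ∫⁻ x, f (A.state n p, x) ∂(A.nextKernel τ n (A.state n p)))
      (hinner.comp hst).aemeasurable]
  refine lintegral_congr fun s => ?_
  change ∫⁻ e, _ ∂(triplesLaw τ) = ∫⁻ e, _ ∂(triplesLaw τ)
  have hhist : Measurable (fun e => A.history s e n) :=
    measurable_snd.comp (hst.comp (measurable_const.prodMk measurable_id))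
  -- The arm pulled is random, so the integral is split by its value `j`; each piece involves the
  -- sample of a fixed arm, which is independent of the history.
  let g : Fin k → (Fin n → ℝ) × ℝ → ENNReal := fun j q =>
    if A.pull n (s, q.1) = j then f ((s, q.1), q.2) else 0
  have hg : ∀ j, Measurable (g j) := fun j =>
    Measurable.ite ((measurableSet_singleton j).preimage
      ((A.measurable_pull n).comp (measurable_const.prodMk measurable_fst)))
      (hf.comp ((measurable_const.prodMk measurable_fst).prodMk measurable_snd)) measurable_const
  have hj : ∀ j, ∫⁻ e, g j (A.history s e n, sample e j n) ∂(triplesLaw τ) =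
      ∫⁻ e, ∫⁻ x, g j (A.history s e n, x) ∂((τ j).map mix) ∂(triplesLaw τ) := by
    intro j
    have hi := (indepFun_iff_map_prod_eq_prod_map_map hhist.aemeasurable
      (measurable_sample j n).aemeasurable).1 (A.indepFun_history_sample τ s n j)
    rw [← lintegral_map (hg j) (hhist.prodMk (measurable_sample j n)), hi,
      triplesLaw_map_sample, lintegral_prod _ (hg j).aemeasurable,
      lintegral_map (hg j).lintegral_prod_right' hhist]
  calc ∫⁻ e, f (A.state n (s, e), A.next n (s, e)) ∂(triplesLaw τ)
      = ∫⁻ e, ∑ j, g j (A.history s e n, sample e j n) ∂(triplesLaw τ) := by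
        refine lintegral_congr fun e => ?_
        simp only [g, Finset.sum_ite_eq, Finset.mem_univ, if_true]
        rfl
    _ = ∑ j, ∫⁻ e, g j (A.history s e n, sample e j n) ∂(triplesLaw τ) :=
        lintegral_finsetSum _ fun j _ => (hg j).comp (hhist.prodMk (measurable_sample j n))
    _ = ∑ j, ∫⁻ e, ∫⁻ x, g j (A.history s e n, x) ∂((τ j).map mix) ∂(triplesLaw τ) :=
        Finset.sum_congr rfl fun j _ => hj j
    _ = ∫⁻ e, ∑ j, ∫⁻ x, g j (A.history s e n, x) ∂((τ j).map mix) ∂(triplesLaw τ) :=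
        (lintegral_finsetSum _ fun j _ =>
          ((hg j).lintegral_prod_right' (ν := (τ j).map mix)).comp hhist).symm
    _ = ∫⁻ e, ∫⁻ x, f (A.state n (s, e), x) ∂(A.nextKernel τ n (A.state n (s, e)))
          ∂(triplesLaw τ) := by
        refine lintegral_congr fun e => ?_
        rw [Finset.sum_eq_single (A.pull n (s, A.history s e n))]
        · simp only [g, if_true]
          rfl
        · intro j _ hjne
          simp only [g, if_neg hjne.symm, lintegral_zero]
        · simp

lemma lintegral_state_next (n : ℕ) {f : (A.Seed × (Fin n → ℝ)) × ℝ → ENNReal}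
    (hf : Measurable f) :
    ∫⁻ p, f (A.state n p, A.next n p) ∂(A.jointLaw (productInstance τ)) =
      ∫⁻ p, ∫⁻ x, f (A.state n p, x) ∂((τ (A.arm n p)).map mix)
        ∂(A.jointLaw (productInstance τ)) := by
  rw [← lintegral_map hf ((A.measurable_state n).prodMk (A.measurable_next n)),
    map_state_next, Measure.lintegral_compProd hf,
    lintegral_map hf.lintegral_kernel_prod_right' (A.measurable_state n)]
  rfl

lemma integral_state_next (n : ℕ) {f : (A.Seed × (Fin n → ℝ)) × ℝ → ℝ}
    (hf : Measurable f) {C : ℝ} (hC : ∀ q, |f q| ≤ C) :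
    ∫ p, f (A.state n p, A.next n p) ∂(A.jointLaw (productInstance τ)) =
      ∫ p, ∫ x, f (A.state n p, x) ∂((τ (A.arm n p)).map mix)
        ∂(A.jointLaw (productInstance τ)) := by
  have hm := (A.measurable_state n).prodMk (A.measurable_next n)
  have := Measure.isProbabilityMeasure_map (μ := A.jointLaw (productInstance τ))
    (A.measurable_state n).aemeasurable
  rw [← integral_map (φ := fun p => (A.state n p, A.next n p)) hm.aemeasurable
      hf.aestronglyMeasurable, map_state_next,
    Measure.integral_compProd (Integrable.of_bound hf.aestronglyMeasurable C
      (Filter.Eventually.of_forall hC)),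
    integral_map (A.measurable_state n).aemeasurable]
  · rfl
  · exact (hf.stronglyMeasurable.integral_kernel_prod_right').aestronglyMeasurable

end OneStep

end Algorithm

/-! ### Stopping and the stopped log-likelihood ratio -/

namespace Algorithm

variable {k : ℕ} (A : Algorithm k)

/-- The state one round earlier. -/
def previous {n : ℕ} (q : A.Seed × (Fin (n + 1) → ℝ)) : A.Seed × (Fin n → ℝ) :=
  (q.1, Fin.init (α := fun _ => ℝ) q.2)

lemma measurable_previous {n : ℕ} : Measurable (A.previous (n := n)) := by
  refine measurable_fst.prodMk (measurable_pi_iff.2 fun i => ?_)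
  exact (measurable_pi_apply i.castSucc).comp measurable_snd

lemma previous_state (n : ℕ) (p : A.Seed × Triples k) :
    A.previous (A.state (n + 1) p) = A.state n p := by
  rw [state_succ, previous, Fin.init_snoc]
  rfl

/-- The states in which the algorithm has not stopped before. -/
def running : (n : ℕ) → Set (A.Seed × (Fin n → ℝ))
  | 0 => Set.univ
  | n + 1 => A.previous ⁻¹' (running n \ A.halt n)

lemma measurableSet_running (n : ℕ) : MeasurableSet (A.running n) := by
  induction n with
  | zero => exact MeasurableSet.univ
  | succ n ih => exact (ih.diff (A.measurableSet_halt n)).preimage A.measurable_previous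

lemma state_succ_mem_running {n : ℕ} {p : A.Seed × Triples k} :
    A.state (n + 1) p ∈ A.running (n + 1) ↔
      A.state n p ∈ A.running n ∧ A.state n p ∉ A.halt n := by
  change A.previous _ ∈ A.running n \ A.halt n ↔ _
  rw [previous_state, Set.mem_sdiff]

lemma state_mem_running_iff {n : ℕ} {p : A.Seed × Triples k} :
    A.state n p ∈ A.running n ↔ ∀ m < n, A.state m p ∉ A.halt m := by
  induction n with
  | zero => simp [running]
  | succ n ih =>
    rw [state_succ_mem_running, ih]
    constructor
    · rintro ⟨h1, h2⟩ m hm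
      rcases Nat.lt_succ_iff_lt_or_eq.1 hm with h | rfl
      · exact h1 m h
      · exact h2
    · exact fun h => ⟨fun m hm => h m (by omega), h n (by omega)⟩

lemma state_mem_running_mono {m n : ℕ} (h : m ≤ n) {p : A.Seed × Triples k}
    (hp : A.state n p ∈ A.running n) : A.state m p ∈ A.running m := by
  rw [state_mem_running_iff] at hp ⊢
  exact fun l hl => hp l (by omega)

lemma le_sampleCount_iff {n : ℕ} {p : A.Seed × Triples k} :
    (n : ℕ∞) ≤ A.sampleCount p.1 p.2 ↔ A.state n p ∈ A.running n := by
  rw [state_mem_running_iff, sampleCount, le_iInf₂_iff]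
  refine forall_congr' fun m => ?_
  rw [Nat.cast_le]
  constructor
  · intro h hm hh
    exact absurd (h hh) (by omega)
  · intro h hh
    by_contra! hm
    exact h hm hh

lemma sampleCount_eq_iff {n : ℕ} {p : A.Seed × Triples k} :
    A.sampleCount p.1 p.2 = (n : ℕ∞) ↔ A.state n p ∈ A.running n ∩ A.halt n := by
  have h1 : A.sampleCount p.1 p.2 = (n : ℕ∞) ↔ (n : ℕ∞) ≤ A.sampleCount p.1 p.2 ∧
      ¬ ((n + 1 : ℕ) : ℕ∞) ≤ A.sampleCount p.1 p.2 := by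
    rw [Nat.cast_add, Nat.cast_one, ENat.add_one_le_iff (ENat.natCast_ne_top n), not_lt]
    exact ⟨fun h => ⟨h.ge, h.le⟩, fun h => le_antisymm h.2 h.1⟩
  rw [h1, le_sampleCount_iff, le_sampleCount_iff, state_succ_mem_running, Set.mem_inter_iff]
  tauto

section LogLikelihood

variable (r : Fin k → ℝ → ℝ)

/-- The log-likelihood ratio of the first `n` samples. -/
def llr : (n : ℕ) → A.Seed × (Fin n → ℝ) → ℝ
  | 0, _ => 0
  | n + 1, q => llr n (A.previous q) +
      Real.log (r (A.pull n (A.previous q)) (q.2 (Fin.last n)))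

lemma llr_state_succ (n : ℕ) (p : A.Seed × Triples k) :
    A.llr r (n + 1) (A.state (n + 1) p) =
      A.llr r n (A.state n p) + Real.log (r (A.arm n p) (A.next n p)) := by
  have h : (A.state (n + 1) p).2 (Fin.last n) = A.next n p :=
    Fin.snoc_last (α := fun _ => ℝ) _ _
  rw [llr, previous_state, h, arm]

/-- The log-likelihood ratio of the samples received before stopping, up to round `n`. -/
def stoppedLlr (n : ℕ) (p : A.Seed × Triples k) : ℝ :=
  -- The sample of round `m` is really taken exactly when the algorithm has not stopped in rounds
  -- `0, ..., m`, hence the index `m + 1`.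
  ∑ m ∈ Finset.range n, (A.state (m + 1) ⁻¹' A.running (m + 1)).indicator
    (fun p => Real.log (r (A.arm m p) (A.next m p))) p

lemma stoppedLlr_eq_llr {n : ℕ} {p : A.Seed × Triples k} (hp : A.state n p ∈ A.running n) :
    A.stoppedLlr r n p = A.llr r n (A.state n p) := by
  induction n with
  | zero => simp [stoppedLlr, llr]
  | succ n ih =>
    rw [stoppedLlr, Finset.sum_range_succ,
      Set.indicator_of_mem (s := A.state (n + 1) ⁻¹' A.running (n + 1)) hp, llr_state_succ]
    congr 1
    exact ih (A.state_mem_running_mono n.le_succ hp)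

lemma stoppedLlr_eq_of_halt {m n : ℕ} (h : m ≤ n) {p : A.Seed × Triples k}
    (hp : A.state m p ∈ A.running m ∩ A.halt m) :
    A.stoppedLlr r n p = A.llr r m (A.state m p) := by
  rw [← A.stoppedLlr_eq_llr r hp.1, stoppedLlr, stoppedLlr,
    ← Finset.sum_range_add_sum_Ico _ h, add_eq_left]
  refine Finset.sum_eq_zero fun l hl => Set.indicator_of_notMem (fun hl' => ?_) _
  rw [Set.mem_preimage, state_mem_running_iff] at hl'
  exact hl' m (by have := (Finset.mem_Ico.1 hl).1; omega) hp.2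

variable {r} (hr : ∀ i, Measurable (r i))
include hr

lemma measurable_log_density {Ω : Type*} [MeasurableSpace Ω] {f : Ω → Fin k} {g : Ω → ℝ}
    (hf : Measurable f) (hg : Measurable g) : Measurable fun p => Real.log (r (f p) (g p)) := by
  have h1 : Measurable (fun q : Fin k × ℝ => r q.1 q.2) :=
    measurable_from_prod_countable_right fun i => hr i
  exact Real.measurable_log.comp (h1.comp (hf.prodMk hg))

lemma measurable_llr (n : ℕ) : Measurable (A.llr r n) := by
  induction n with
  | zero => exact measurable_const
  | succ n ih =>
    exact (ih.comp A.measurable_previous).add (measurable_log_density hr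
      ((A.measurable_pull n).comp A.measurable_previous)
      ((measurable_pi_apply _).comp measurable_snd))

lemma measurable_stoppedLlr (n : ℕ) : Measurable (A.stoppedLlr r n) :=
  Finset.measurable_sum _ fun m _ =>
    (measurable_log_density hr (A.measurable_arm m) (A.measurable_next m)).indicator
      ((A.measurableSet_running (m + 1)).preimage (A.measurable_state (m + 1)))

end LogLikelihood

end Algorithm

/-! ### Change of measure -/

namespace Algorithm

variable {k : ℕ} (A : Algorithm k)

section ChangeOfMeasure

variable {τ τ' : Fin k → Measure (ℝ × Bool × ℝ)} [∀ i, IsProbabilityMeasure (τ i)]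
  [∀ i, IsProbabilityMeasure (τ' i)] {r : Fin k → ℝ → ℝ}

/-- The seed and the pulling rule are common to both instances, so each round contributes only the
density of the received sample. -/
lemma lintegral_state_change (hr : ∀ i, Measurable (r i)) (hpos : ∀ i x, 0 < r i x)
    (hd : ∀ (i : Fin k) (f : ℝ → ENNReal), Measurable f →
      ∫⁻ x, f x * ENNReal.ofReal (r i x) ∂((τ i).map mix) = ∫⁻ x, f x ∂((τ' i).map mix))
    (n : ℕ) {f : A.Seed × (Fin n → ℝ) → ENNReal} (hf : Measurable f) :
    ∫⁻ p, f (A.state n p) ∂(A.jointLaw (productInstance τ')) =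
      ∫⁻ p, f (A.state n p) * ENNReal.ofReal (Real.exp (A.llr r n (A.state n p)))
        ∂(A.jointLaw (productInstance τ)) := by
  induction n with
  | zero =>
    have h : ∀ ν : Instance k, ∫⁻ p, f (A.state 0 p) ∂(A.jointLaw ν) =
        ∫⁻ s, f (s, Fin.elim0) ∂(A.seedLaw : Measure A.Seed) := by
      intro ν
      rw [jointLaw, lintegral_prod (fun p => f (A.state 0 p))
        (hf.comp (A.measurable_state 0)).aemeasurable]
      refine lintegral_congr fun s => ?_
      change ∫⁻ _, f (s, Fin.elim0) ∂_ = _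
      rw [lintegral_const, measure_univ, mul_one]
    simp only [llr, Real.exp_zero, ENNReal.ofReal_one, mul_one]
    rw [h, h]
  | succ n ih =>
    let g : (A.Seed × (Fin n → ℝ)) × ℝ → ENNReal := fun q =>
      f (q.1.1, Fin.snoc (α := fun _ => ℝ) q.1.2 q.2)
    have hg : Measurable g := hf.comp (A.measurable_snoc n)
    have hr2 : Measurable fun q : (A.Seed × (Fin n → ℝ)) × ℝ => r (A.pull n q.1) q.2 :=
      (measurable_from_prod_countable_right (f := fun q : Fin k × ℝ => r q.1 q.2) hr).comp
        (((A.measurable_pull n).comp measurable_fst).prodMk measurable_snd)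
    let w : A.Seed × (Fin n → ℝ) → ENNReal := fun q => ENNReal.ofReal (Real.exp (A.llr r n q))
    have hw : Measurable w := (Real.measurable_exp.comp (A.measurable_llr hr n)).ennreal_ofReal
    have h1 : Measurable fun q => ∫⁻ x, g (q, x) ∂(A.nextKernel τ' n q) :=
      hg.lintegral_kernel_prod_right'
    calc ∫⁻ p, f (A.state (n + 1) p) ∂(A.jointLaw (productInstance τ'))
        = ∫⁻ p, g (A.state n p, A.next n p) ∂(A.jointLaw (productInstance τ')) := rfl
      _ = ∫⁻ p, ∫⁻ x, g (A.state n p, x) ∂((τ' (A.arm n p)).map mix)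
            ∂(A.jointLaw (productInstance τ')) := A.lintegral_state_next τ' n hg
      _ = ∫⁻ p, (∫⁻ x, g (A.state n p, x) ∂((τ' (A.arm n p)).map mix)) * w (A.state n p)
            ∂(A.jointLaw (productInstance τ)) := ih h1
      _ = ∫⁻ p, ∫⁻ x, (g (A.state n p, x) * ENNReal.ofReal (r (A.arm n p) x) *
            w (A.state n p)) ∂((τ (A.arm n p)).map mix) ∂(A.jointLaw (productInstance τ)) := by
          refine lintegral_congr fun p => ?_
          have hgp : Measurable fun x => g (A.state n p, x) :=
            hg.comp (measurable_const.prodMk measurable_id)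
          have hm : Measurable fun x => g (A.state n p, x) * ENNReal.ofReal (r (A.arm n p) x) :=
            hgp.mul (hr _).ennreal_ofReal
          rw [lintegral_mul_const _ hm, hd _ _ hgp]
      _ = ∫⁻ p, g (A.state n p, A.next n p) * ENNReal.ofReal (r (A.arm n p) (A.next n p)) *
            w (A.state n p) ∂(A.jointLaw (productInstance τ)) :=
          (A.lintegral_state_next τ n (f := fun q =>
            g q * ENNReal.ofReal (r (A.pull n q.1) q.2) * w q.1)
            ((hg.mul hr2.ennreal_ofReal).mul (hw.comp measurable_fst))).symm
      _ = _ := by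
          refine lintegral_congr fun p => ?_
          rw [llr_state_succ, add_comm (A.llr r n _), Real.exp_add,
            Real.exp_log (hpos _ _), ENNReal.ofReal_mul (hpos _ _).le, ← mul_assoc]
          rfl

variable (hr : ∀ i, Measurable (r i)) (hpos : ∀ i x, 0 < r i x)
    (hd : ∀ (i : Fin k) (f : ℝ → ENNReal), Measurable f →
      ∫⁻ x, f x * ENNReal.ofReal (r i x) ∂((τ i).map mix) = ∫⁻ x, f x ∂((τ' i).map mix))
include hr hpos hd

lemma setLIntegral_llr (n : ℕ) {S : Set (A.Seed × (Fin n → ℝ))} (hS : MeasurableSet S) :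
    ∫⁻ p in A.state n ⁻¹' S, ENNReal.ofReal (Real.exp (A.llr r n (A.state n p)))
        ∂(A.jointLaw (productInstance τ)) =
      A.jointLaw (productInstance τ') (A.state n ⁻¹' S) := by
  have hS' := hS.preimage (A.measurable_state n)
  have h := A.lintegral_state_change hr hpos hd n (measurable_one.indicator hS)
  rw [← lintegral_indicator_one hS', ← lintegral_indicator hS']
  refine Eq.trans (lintegral_congr fun p => ?_) (h.symm.trans (lintegral_congr fun p => ?_))
  · by_cases hp : A.state n p ∈ S
    · rw [Set.indicator_of_mem (s := A.state n ⁻¹' S) hp, Set.indicator_of_mem hp]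
      simp
    · rw [Set.indicator_of_notMem (s := A.state n ⁻¹' S) hp, Set.indicator_of_notMem hp]
      simp
  · by_cases hp : A.state n p ∈ S
    · rw [Set.indicator_of_mem (s := A.state n ⁻¹' S) hp, Set.indicator_of_mem hp]
      rfl
    · rw [Set.indicator_of_notMem (s := A.state n ⁻¹' S) hp, Set.indicator_of_notMem hp]

lemma setLIntegral_stoppedLlr_running (n : ℕ) :
    ∫⁻ p in A.state n ⁻¹' A.running n, ENNReal.ofReal (Real.exp (A.stoppedLlr r n p))
        ∂(A.jointLaw (productInstance τ)) =
      A.jointLaw (productInstance τ') (A.state n ⁻¹' A.running n) := by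
  rw [← A.setLIntegral_llr hr hpos hd n (A.measurableSet_running n)]
  refine setLIntegral_congr_fun ((A.measurableSet_running n).preimage (A.measurable_state n))
    fun p hp => ?_
  rw [A.stoppedLlr_eq_llr r hp]

/-- The event that the algorithm stops before round `n`, in one of the states `S m`. -/
def stopsIn (n : ℕ) (S : (m : ℕ) → Set (A.Seed × (Fin m → ℝ))) : Set (A.Seed × Triples k) :=
  ⋃ m ∈ Finset.range n, A.state m ⁻¹' (A.running m ∩ A.halt m ∩ S m)

omit hr hpos hd in
lemma measurableSet_stopsIn (n : ℕ) {S : (m : ℕ) → Set (A.Seed × (Fin m → ℝ))}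
    (hS : ∀ m, MeasurableSet (S m)) : MeasurableSet (A.stopsIn n S) :=
  Finset.measurableSet_biUnion _ fun m _ =>
    (((A.measurableSet_running m).inter (A.measurableSet_halt m)).inter (hS m)).preimage
      (A.measurable_state m)

/-- Splitting by the stopping time reduces this to the change of measure at each deterministic time
`m`, where the stopped ratio is already frozen. -/
lemma setLIntegral_stoppedLlr_stopsIn (n : ℕ) {S : (m : ℕ) → Set (A.Seed × (Fin m → ℝ))}
    (hS : ∀ m, MeasurableSet (S m)) :
    ∫⁻ p in A.stopsIn n S, ENNReal.ofReal (Real.exp (A.stoppedLlr r n p))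
        ∂(A.jointLaw (productInstance τ)) =
      A.jointLaw (productInstance τ') (A.stopsIn n S) := by
  have hm : ∀ m, MeasurableSet (A.running m ∩ A.halt m ∩ S m) := fun m =>
    ((A.measurableSet_running m).inter (A.measurableSet_halt m)).inter (hS m)
  have hmeas : ∀ m ∈ Finset.range n,
      MeasurableSet (A.state m ⁻¹' (A.running m ∩ A.halt m ∩ S m)) :=
    fun m _ => (hm m).preimage (A.measurable_state m)
  have hdisj : (Finset.range n : Set ℕ).PairwiseDisjoint
      fun m => A.state m ⁻¹' (A.running m ∩ A.halt m ∩ S m) := by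
    intro l _ m _ hlm
    refine Set.disjoint_left.2 fun p hp hp' => hlm ?_
    have h1 := A.sampleCount_eq_iff.2 hp.1
    rw [A.sampleCount_eq_iff.2 hp'.1] at h1
    exact (Nat.cast_injective h1).symm
  rw [stopsIn, lintegral_biUnion_finset hdisj hmeas, measure_biUnion_finset hdisj hmeas]
  refine Finset.sum_congr rfl fun m hmn => ?_
  rw [← A.setLIntegral_llr hr hpos hd m (hm m)]
  refine setLIntegral_congr_fun (hmeas m hmn) fun p hp => ?_
  rw [A.stoppedLlr_eq_of_halt r (Finset.mem_range.1 hmn).le hp.1]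

omit hr hpos hd in
lemma stopsIn_univ (n : ℕ) :
    A.stopsIn n (fun _ => Set.univ) = (A.state n ⁻¹' A.running n)ᶜ := by
  ext p
  simp only [stopsIn, Set.mem_iUnion, Set.mem_preimage, Set.mem_compl_iff, Set.inter_univ,
    ← A.le_sampleCount_iff, ← A.sampleCount_eq_iff, Finset.mem_range, not_le]
  constructor
  · rintro ⟨m, hm, h⟩
    rw [h]
    exact_mod_cast hm
  · intro h
    obtain ⟨m, hm⟩ := ENat.ne_top_iff_exists.1 (h.trans_le le_top).ne
    rw [← hm] at h ⊢
    exact ⟨m, by exact_mod_cast h, rfl⟩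

lemma lintegral_stoppedLlr (n : ℕ) :
    ∫⁻ p, ENNReal.ofReal (Real.exp (A.stoppedLlr r n p))
        ∂(A.jointLaw (productInstance τ)) = 1 := by
  have hS : MeasurableSet (A.state n ⁻¹' A.running n) :=
    (A.measurableSet_running n).preimage (A.measurable_state n)
  have h := A.setLIntegral_stoppedLlr_stopsIn hr hpos hd n (S := fun _ => Set.univ)
    (fun _ => MeasurableSet.univ)
  rw [stopsIn_univ] at h
  rw [← lintegral_add_compl _ hS, h, A.setLIntegral_stoppedLlr_running hr hpos hd,
    measure_add_measure_compl hS, measure_univ]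

omit hr hpos hd [∀ i, IsProbabilityMeasure (τ i)] in
lemma abs_stoppedLlr_le {C : ℝ} (hC : ∀ i x, |Real.log (r i x)| ≤ C) (n : ℕ)
    (p : A.Seed × Triples k) : |A.stoppedLlr r n p| ≤ n * C := by
  classical
  refine (Finset.abs_sum_le_sum_abs _ _).trans ?_
  rw [← nsmul_eq_mul, ← Finset.card_range n, ← Finset.sum_const, Finset.card_range]
  refine Finset.sum_le_sum fun m _ => ?_
  rw [Set.indicator_apply]
  split_ifs
  · exact hC _ _
  · rw [abs_zero]
    exact (abs_nonneg _).trans (hC (A.arm m p) 0)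

/-- A form of the data processing inequality for the event `S` that an algorithm stops in certain
states, which has probability at most `δ` under the alternative instance. -/
lemma neg_integral_stoppedLlr_ge {C : ℝ} (hC : ∀ i x, |Real.log (r i x)| ≤ C) (n : ℕ)
    {S : (m : ℕ) → Set (A.Seed × (Fin m → ℝ))} (hS : ∀ m, MeasurableSet (S m)) {δ : ℝ}
    (hδ : 0 < δ) (hP : A.jointLaw (productInstance τ') (A.stopsIn n S) ≤ ENNReal.ofReal δ) :
    (A.jointLaw (productInstance τ)).real (A.stopsIn n S) * Real.log (1 / δ) - Real.log 2 ≤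
      -∫ p, A.stoppedLlr r n p ∂(A.jointLaw (productInstance τ)) := by
  set P := A.jointLaw (productInstance τ)
  set L := A.stoppedLlr r n
  set E := A.stopsIn n S
  have hE : MeasurableSet E := A.measurableSet_stopsIn n hS
  have hLm : Measurable L := A.measurable_stoppedLlr hr n
  have hLb : ∀ p, |L p| ≤ n * C := A.abs_stoppedLlr_le hC n
  have hLi : Integrable L P :=
    Integrable.of_bound hLm.aestronglyMeasurable _ (Filter.Eventually.of_forall hLb)
  have hei : Integrable (fun p => Real.exp (L p)) P := by
    refine Integrable.of_bound (Real.measurable_exp.comp hLm).aestronglyMeasurable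
      (Real.exp (n * C)) (Filter.Eventually.of_forall fun p => ?_)
    rw [Real.norm_eq_abs, Real.abs_exp]
    exact Real.exp_le_exp.2 ((le_abs_self _).trans (hLb p))
  have h1 : ∫ p, Real.exp (L p) ∂P = 1 := by
    rw [integral_eq_lintegral_of_nonneg_ae (Filter.Eventually.of_forall fun p => (Real.exp_pos _).le)
      hei.aestronglyMeasurable, A.lintegral_stoppedLlr hr hpos hd n, ENNReal.toReal_one]
  have h2 : ∫ p in E, Real.exp (L p) ∂P ≤ δ := by
    rw [integral_eq_lintegral_of_nonneg_ae (Filter.Eventually.of_forall fun p => (Real.exp_pos _).le)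
      hei.integrableOn.aestronglyMeasurable, A.setLIntegral_stoppedLlr_stopsIn hr hpos hd n hS]
    exact ENNReal.toReal_le_of_le_ofReal hδ.le hP
  -- This is the tangent line of the logarithm at `c`. It is used with `c = 2 δ` on `E` and `c = 2`
  -- off `E`: the two exponential integrals then contribute at most 1/2 each, which cancels the
  -- `-1`.
  have key : ∀ c : ℝ, 0 < c → ∀ x : ℝ, x ≤ Real.exp x / c - 1 + Real.log c := by
    intro c hc x
    have := Real.log_le_sub_one_of_pos (div_pos (Real.exp_pos x) hc)
    rw [Real.log_div (Real.exp_pos x).ne' hc.ne', Real.log_exp] at this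
    linarith
  have hset : ∀ (F : Set (A.Seed × Triples k)) (c : ℝ), 0 < c → MeasurableSet F →
      ∫ p in F, L p ∂P ≤ (∫ p in F, Real.exp (L p) ∂P) / c + P.real F * (Real.log c - 1) := by
    intro F c hc hF
    have hi1 : IntegrableOn (fun p => Real.exp (L p) / c) F P := (hei.div_const c).integrableOn
    have hi2 : IntegrableOn (fun _ => Real.log c - 1) F P := integrable_const _
    calc ∫ p in F, L p ∂P ≤ ∫ p in F, (Real.exp (L p) / c + (Real.log c - 1)) ∂P :=
          setIntegral_mono hLi.integrableOn (hi1.add hi2) fun p => by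
            linarith [key c hc (L p)]
      _ = _ := by
          rw [integral_add hi1 hi2, integral_div, setIntegral_const, smul_eq_mul]
  have hE1 := hset E (2 * δ) (by positivity) hE
  have hE2 := hset Eᶜ 2 (by norm_num) hE.compl
  have hsum := integral_add_compl hE hei
  have hsumL := integral_add_compl hE hLi
  have hc : P.real E + P.real Eᶜ = 1 := by
    rw [measureReal_add_measureReal_compl hE, probReal_univ]
  have h3 : (∫ p in E, Real.exp (L p) ∂P) / (2 * δ) ≤ 1 / 2 := by
    rw [div_le_iff₀ (by positivity)]
    linarith
  have h4 : (∫ p in Eᶜ, Real.exp (L p) ∂P) / 2 ≤ 1 / 2 := by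
    have : 0 ≤ ∫ p in E, Real.exp (L p) ∂P := integral_nonneg fun p => (Real.exp_pos _).le
    linarith
  have h5 : Real.log (2 * δ) = Real.log 2 + Real.log δ := Real.log_mul (by norm_num) hδ.ne'
  rw [h5] at hE1
  rw [one_div, Real.log_inv]
  have h6 : P.real E * (Real.log 2 + Real.log δ - 1) + P.real Eᶜ * (Real.log 2 - 1) =
      Real.log 2 - 1 + P.real E * Real.log δ := by
    rw [show P.real Eᶜ = 1 - P.real E by linarith]
    ring
  linarith

end ChangeOfMeasure

end Algorithm

/-! ### Outputs, pull counts and the Wald bound -/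

namespace Algorithm

variable {k : ℕ} (A : Algorithm k)

/-- The event that the algorithm takes more than `n` samples. -/
def continues (n : ℕ) : Set (A.Seed × Triples k) := A.state (n + 1) ⁻¹' A.running (n + 1)

/-- The event that the algorithm stops and outputs the arm `j`. -/
def outputs (j : Fin k) : Set (A.Seed × Triples k) :=
  {p | ∃ n : ℕ, A.sampleCount p.1 p.2 = (n : ℕ∞) ∧ A.output n (A.state n p) = j}

/-- The states in which the output is not `j`. -/
def missing (j : Fin k) (n : ℕ) : Set (A.Seed × (Fin n → ℝ)) := {q | A.output n q ≠ j}

lemma measurableSet_continues (n : ℕ) : MeasurableSet (A.continues n) :=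
  (A.measurableSet_running (n + 1)).preimage (A.measurable_state (n + 1))

lemma measurableSet_missing (j : Fin k) (n : ℕ) : MeasurableSet (A.missing j n) :=
  ((measurableSet_singleton j).preimage (A.measurable_output n)).compl

lemma measurableSet_outputs (j : Fin k) : MeasurableSet (A.outputs j) := by
  have h : A.outputs j = ⋃ n, A.state n ⁻¹' (A.running n ∩ A.halt n ∩ (A.missing j n)ᶜ) := by
    ext p
    simp [outputs, missing, A.sampleCount_eq_iff]
  rw [h]
  exact MeasurableSet.iUnion fun n =>
    (((A.measurableSet_running n).inter (A.measurableSet_halt n)).inter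
      (A.measurableSet_missing j n).compl).preimage (A.measurable_state n)

lemma disjoint_outputs {i j : Fin k} (h : i ≠ j) : Disjoint (A.outputs i) (A.outputs j) := by
  refine Set.disjoint_left.2 fun p hp hp' => h ?_
  obtain ⟨n, hn, rfl⟩ := hp
  obtain ⟨m, hm, rfl⟩ := hp'
  rw [hn] at hm
  obtain rfl := Nat.cast_injective hm
  rfl

lemma mem_stopsIn_missing {n : ℕ} {j : Fin k} {p : A.Seed × Triples k} :
    p ∈ A.stopsIn n (A.missing j) ↔
      ∃ m < n, A.sampleCount p.1 p.2 = (m : ℕ∞) ∧ A.output m (A.state m p) ≠ j := by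
  simp only [stopsIn, missing, A.sampleCount_eq_iff, Set.mem_iUnion, Finset.mem_range,
    exists_prop]
  rfl

lemma disjoint_stopsIn_outputs (n : ℕ) (j : Fin k) :
    Disjoint (A.stopsIn n (A.missing j)) (A.outputs j) := by
  refine Set.disjoint_left.2 fun p hp hp' => ?_
  obtain ⟨m, _, hm, hne⟩ := A.mem_stopsIn_missing.1 hp
  obtain ⟨l, hl, he⟩ := hp'
  rw [hl] at hm
  obtain rfl := Nat.cast_injective hm
  exact hne he

lemma univ_subset_stopsIn_union (n : ℕ) (j : Fin k) :
    Set.univ ⊆ A.stopsIn (n + 1) (A.missing j) ∪ A.continues n ∪ A.outputs j := by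
  intro p _
  by_cases hc : p ∈ A.continues n
  · exact Or.inl (Or.inr hc)
  · have h1 : p ∈ A.stopsIn (n + 1) (fun _ => Set.univ) := by
      rw [stopsIn_univ]
      exact hc
    simp only [stopsIn, Set.inter_univ, Set.mem_iUnion, Set.mem_preimage,
      ← A.sampleCount_eq_iff, Finset.mem_range] at h1
    obtain ⟨m, hm, hT⟩ := h1
    by_cases ho : A.output m (A.state m p) = j
    · exact Or.inr ⟨m, hT, ho⟩
    · exact Or.inl (Or.inl (A.mem_stopsIn_missing.2 ⟨m, hm, hT, ho⟩))

lemma sum_continues_le_sampleCount (n : ℕ) (p : A.Seed × Triples k) :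
    ∑ m ∈ Finset.range n, (A.continues m).indicator 1 p ≤
      (A.sampleCount p.1 p.2 : ENNReal) := by
  classical
  have h : ∀ m, p ∈ A.continues m ↔ (m : ℕ∞) < A.sampleCount p.1 p.2 := fun m => by
    rw [continues, Set.mem_preimage, ← A.le_sampleCount_iff, Nat.cast_add, Nat.cast_one,
      ENat.add_one_le_iff (ENat.natCast_ne_top m)]
  generalize A.sampleCount p.1 p.2 = T at h
  cases T with
  | top => simp
  | coe N =>
    simp only [Set.indicator_apply, h, Nat.cast_lt, Pi.one_apply, Finset.sum_boole]
    rw [ENat.toENNReal_coe, Nat.cast_le]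
    calc (Finset.filter (fun m => m < N) (Finset.range n)).card
        ≤ (Finset.range N).card := Finset.card_le_card fun m hm => by
          simpa using (Finset.mem_filter.1 hm).2
      _ = N := Finset.card_range N

lemma sum_measure_continues_le (ν : Instance k) (n : ℕ) :
    ∑ m ∈ Finset.range n, A.jointLaw ν (A.continues m) ≤ A.expectedSamples ν := by
  have h : ∑ m ∈ Finset.range n, A.jointLaw ν (A.continues m) =
      ∫⁻ p, ∑ m ∈ Finset.range n, (A.continues m).indicator 1 p ∂(A.jointLaw ν) := by
    rw [lintegral_finsetSum _ fun m _ => measurable_one.indicator (A.measurableSet_continues m)]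
    exact Finset.sum_congr rfl fun m _ =>
      (lintegral_indicator_one (A.measurableSet_continues m)).symm
  rw [h]
  exact lintegral_mono fun p => A.sum_continues_le_sampleCount n p

/-- The expected number of pulls of the arm `j` in the first `n` rounds. -/
def pullCount (ν : Instance k) (n : ℕ) (j : Fin k) : ℝ :=
  ∑ m ∈ Finset.range n, (A.jointLaw ν).real (A.continues m ∩ A.arm m ⁻¹' {j})

lemma sum_pullCount (ν : Instance k) (n : ℕ) : ∑ j, A.pullCount ν n j =
    ∑ m ∈ Finset.range n, (A.jointLaw ν).real (A.continues m) := by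
  simp only [pullCount]
  rw [Finset.sum_comm]
  refine Finset.sum_congr rfl fun m _ => ?_
  rw [← measureReal_biUnion_finset]
  · congr 1
    ext p
    simp
  · intro i _ j _ hij
    refine Set.disjoint_left.2 fun p hp hp' => hij ?_
    have h1 : A.arm m p = i := hp.2
    rw [← h1]
    exact hp'.2
  · exact fun j _ => (A.measurableSet_continues m).inter
      ((measurableSet_singleton j).preimage (A.measurable_arm m))

lemma sum_continues_le_toReal (ν : Instance k) (h : A.expectedSamples ν ≠ ⊤) (n : ℕ) :
    ∑ m ∈ Finset.range n, (A.jointLaw ν).real (A.continues m) ≤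
      (A.expectedSamples ν).toReal := by
  simp only [measureReal_def]
  rw [← ENNReal.toReal_sum fun m _ => measure_ne_top _ _]
  exact ENNReal.toReal_mono h (A.sum_measure_continues_le ν n)

lemma tendsto_continues (ν : Instance k) (h : A.expectedSamples ν ≠ ⊤) :
    Filter.Tendsto (fun n => (A.jointLaw ν).real (A.continues n)) Filter.atTop (nhds 0) := by
  have hs : Summable fun n => (A.jointLaw ν).real (A.continues n) :=
    summable_of_sum_range_le (fun _ => measureReal_nonneg) (A.sum_continues_le_toReal ν h)
  exact hs.tendsto_atTop_zero

section Divergence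

variable {τ : Fin k → Measure (ℝ × Bool × ℝ)} [∀ i, IsProbabilityMeasure (τ i)]
  {r : Fin k → ℝ → ℝ}

/-- Whether round `m` is played, and with which arm, is decided by the past. Conditionally on it, a
played round contributes the divergence of arm `j` if `j` is pulled and zero otherwise, because the
other densities are 1. -/
lemma neg_integral_stoppedLlr_le (hr : ∀ i, Measurable (r i)) {C : ℝ}
    (hC : ∀ i x, |Real.log (r i x)| ≤ C) {j : Fin k} {d : ℝ}
    (hj : -∫ x, Real.log (r j x) ∂((τ j).map mix) ≤ d) (hne : ∀ i ≠ j, ∀ x, r i x = 1) (n : ℕ) :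
    -∫ p, A.stoppedLlr r n p ∂(A.jointLaw (productInstance τ)) ≤
      d * A.pullCount (productInstance τ) n j := by
  classical
  set P := A.jointLaw (productInstance τ)
  have hlog : ∀ m, Measurable fun p => Real.log (r (A.arm m p) (A.next m p)) := fun m =>
    measurable_log_density hr (A.measurable_arm m) (A.measurable_next m)
  have hint : ∀ m, Integrable ((A.continues m).indicator
      fun p => Real.log (r (A.arm m p) (A.next m p))) P := fun m =>
    (Integrable.of_bound (hlog m).aestronglyMeasurable C
      (Filter.Eventually.of_forall fun p => hC _ _)).indicator (A.measurableSet_continues m)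
  have hsum : ∫ p, A.stoppedLlr r n p ∂P = ∑ m ∈ Finset.range n,
      ∫ p, (A.continues m).indicator (fun p => Real.log (r (A.arm m p) (A.next m p))) p ∂P :=
    integral_finsetSum _ fun m _ => hint m
  rw [hsum, ← Finset.sum_neg_distrib, pullCount, Finset.mul_sum]
  refine Finset.sum_le_sum fun m _ => ?_
  have hact : MeasurableSet (A.running m \ A.halt m) :=
    (A.measurableSet_running m).diff (A.measurableSet_halt m)
  have hmem : ∀ p, p ∈ A.continues m ↔ A.state m p ∈ A.running m \ A.halt m := fun p =>
    A.state_succ_mem_running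
  let f : (A.Seed × (Fin m → ℝ)) × ℝ → ℝ := fun q =>
    if q.1 ∈ A.running m \ A.halt m then Real.log (r (A.pull m q.1) q.2) else 0
  have hf : Measurable f := Measurable.ite (hact.preimage measurable_fst)
    (measurable_log_density hr ((A.measurable_pull m).comp measurable_fst) measurable_snd)
    measurable_const
  have hfC : ∀ q, |f q| ≤ C := fun q => by
    simp only [f]
    split_ifs
    · exact hC _ _
    · rw [abs_zero]
      exact (abs_nonneg _).trans (hC j 0)
  have h1 : ∫ p, (A.continues m).indicator (fun p => Real.log (r (A.arm m p) (A.next m p))) p ∂P =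
      ∫ p, f (A.state m p, A.next m p) ∂P := by
    refine integral_congr_ae (Filter.Eventually.of_forall fun p => ?_)
    simp only [f, Set.indicator_apply, hmem]
    rfl
  have hev : MeasurableSet (A.continues m ∩ A.arm m ⁻¹' {j}) :=
    (A.measurableSet_continues m).inter ((measurableSet_singleton j).preimage (A.measurable_arm m))
  have h2 : ∀ p, ∫ x, f (A.state m p, x) ∂((τ (A.arm m p)).map mix) =
      (A.continues m ∩ A.arm m ⁻¹' {j}).indicator
        (fun _ => ∫ x, Real.log (r j x) ∂((τ j).map mix)) p := by
    intro p
    rw [Set.indicator_apply]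
    split_ifs with hp
    · obtain ⟨hp1, hp2⟩ := hp
      have hp3 : A.arm m p = j := hp2
      simp only [f, if_pos ((hmem p).1 hp1)]
      rw [hp3, show A.pull m (A.state m p) = j from hp3]
    · simp only [f]
      split_ifs with hr'
      · have hp3 : A.arm m p ≠ j := fun h => hp ⟨(hmem p).2 hr', h⟩
        have hone : ∀ x, r (A.pull m (A.state m p)) x = 1 := hne _ hp3
        simp only [hone, Real.log_one, integral_zero]
      · exact integral_zero _ _
  rw [h1, A.integral_state_next τ m hf hfC, integral_congr_ae (Filter.Eventually.of_forall h2),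
    integral_indicator_const _ hev, smul_eq_mul, ← mul_neg, mul_comm]
  exact mul_le_mul_of_nonneg_right hj measureReal_nonneg

end Divergence

/-- On an alternative instance in which `j` is the only acceptable output, a PAC algorithm rarely
stops with another output. -/
lemma measure_stopsIn_missing_le {adv : Adversary} {ε t B M α δ : ℝ}
    (hA : A.IsPAC adv ε t B M α δ) {ν : Instance k} {j : Fin k} (hν : ν.InClass adv ε t B M j)
    (hgap : ∀ i ≠ j, α < ν.effectiveGap adv ε B j i) (n : ℕ) :
    A.jointLaw ν (A.stopsIn n (A.missing j)) ≤ ENNReal.ofReal δ := by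
  have h1 : ENNReal.ofReal (1 - δ) ≤ A.jointLaw ν (A.outputs j) := by
    refine (hA ν j hν).trans (measure_mono ?_)
    rintro p ⟨m, hm, hg⟩
    refine ⟨m, hm, ?_⟩
    by_contra h
    exact absurd hg (not_le.2 (hgap _ h))
  have h2 : A.jointLaw ν (A.stopsIn n (A.missing j)) + A.jointLaw ν (A.outputs j) ≤ 1 := by
    rw [← measure_union (A.disjoint_stopsIn_outputs n j) (A.measurableSet_outputs j)]
    exact prob_le_one
  by_contra! h
  have hlt : ENNReal.ofReal δ + ENNReal.ofReal (1 - δ) < 1 :=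
    (ENNReal.add_lt_add_of_lt_of_le ENNReal.ofReal_ne_top h h1).trans_le h2
  have hle : (1 : ENNReal) ≤ ENNReal.ofReal δ + ENNReal.ofReal (1 - δ) := by
    rw [← ENNReal.ofReal_one, show (1 : ℝ) = δ + (1 - δ) by ring]
    simpa using ENNReal.ofReal_add_le (p := δ) (q := 1 - δ)
  exact absurd hlt (not_lt.2 hle)

lemma one_le_stopsIn_add (ν : Instance k) (n : ℕ) (j : Fin k) :
    1 ≤ (A.jointLaw ν).real (A.stopsIn (n + 1) (A.missing j)) +
      (A.jointLaw ν).real (A.continues n) + (A.jointLaw ν).real (A.outputs j) := by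
  rw [← probReal_univ (μ := A.jointLaw ν)]
  refine (measureReal_mono (A.univ_subset_stopsIn_union n j)).trans ?_
  exact (measureReal_union_le _ _).trans (add_le_add (measureReal_union_le _ _) le_rfl)

/-- All arms but one are output with probability at most one half. -/
lemma exists_outputs_le_half (ν : Instance k) (b : Fin k) :
    ∃ j₀, ∀ j ≠ j₀, (A.jointLaw ν).real (A.outputs j) ≤ 1 / 2 := by
  by_cases h : ∃ j₀, 1 / 2 < (A.jointLaw ν).real (A.outputs j₀)
  · obtain ⟨j₀, hj₀⟩ := h
    refine ⟨j₀, fun j hj => ?_⟩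
    have h1 : (A.jointLaw ν).real (A.outputs j) + (A.jointLaw ν).real (A.outputs j₀) ≤ 1 := by
      rw [← measureReal_union (A.disjoint_outputs hj) (A.measurableSet_outputs j₀)]
      exact measureReal_le_one
    linarith
  · push Not at h
    exact ⟨b, fun j _ => h j⟩

end Algorithm

/-! ### The sample complexity bound -/

namespace Algorithm

variable {k : ℕ} (A : Algorithm k) {adv : Adversary} {ε : ℝ}

/-- The cost of excluding the alternative in which the observed median of the arm `j` is `x`. -/
lemma stopsIn_missing_le_pullCount (hε : ε ∈ Set.Ioo (0 : ℝ) (1 / 15)) {θ : Fin k → ℝ}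
    (hθ : ∀ i, |θ i| ≤ 1 / 3) (b j : Fin k) {x t α δ : ℝ} (hx : |x| ≤ 1 / 3)
    (ht : t ∈ Set.Ioo (0 : ℝ) (1 / 10)) (hα : 0 ≤ α) (hδ : 0 < δ)
    (hA : A.IsPAC adv ε t 4 (5 / 2) α δ) (hj : ∀ i ≠ j, α < x - θ i) (n : ℕ) :
    (A.jointLaw (hardInstance adv hε hθ b)).real (A.stopsIn n (A.missing j)) *
        Real.log (1 / δ) - Real.log 2 ≤
      (x - θ j) ^ 2 / 5 * A.pullCount (hardInstance adv hε hθ b) n j := by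
  classical
  set θ' := Function.update θ j x
  have hθ'j : θ' j = x := Function.update_self _ _ _
  have hθ'i : ∀ i ≠ j, θ' i = θ i := fun i hi => Function.update_of_ne hi _ _
  have hθ' : ∀ i, |θ' i| ≤ 1 / 3 := by
    intro i
    by_cases hi : i = j
    · rw [hi, hθ'j]; exact hx
    · rw [hθ'i i hi]; exact hθ i
  have hη : obsLevel adv ε ∈ Set.Ico (0 : ℝ) 1 := obsLevel_mem hε
  have hclass : (hardInstance adv hε hθ' j).InClass adv ε t 4 (5 / 2) j := by
    refine hardInstance_inClass hε hθ' j ht fun i hi => ?_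
    rw [hθ'j, hθ'i i hi]
    linarith [hj i hi]
  have hsmall := A.measure_stopsIn_missing_le hA hclass (fun i hi => by
    rw [hardInstance_effectiveGap hε hθ' j hi, hθ'j, hθ'i i hi]
    exact hj i hi) n
  let r : Fin k → ℝ → ℝ := fun i =>
    if i = j then obsDensity (obsLevel adv ε) (θ j) x else fun _ => 1
  have hrj : r j = obsDensity (obsLevel adv ε) (θ j) x := if_pos rfl
  have hri : ∀ i ≠ j, r i = fun _ => 1 := fun i hi => if_neg hi
  have hr : ∀ i, Measurable (r i) := by
    intro i
    by_cases hi : i = j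
    · rw [hi, hrj]; exact measurable_obsDensity _ _ _
    · rw [hri i hi]; exact measurable_const
  have hpos : ∀ i y, 0 < r i y := by
    intro i y
    by_cases hi : i = j
    · rw [hi, hrj]; exact obsDensity_pos hη (hθ j) hx y
    · rw [hri i hi]; exact one_pos
  obtain ⟨C, hC⟩ : ∃ C, ∀ i y, |Real.log (r i y)| ≤ C := by
    obtain ⟨C, hC⟩ := exists_abs_log_obsDensity_le (obsLevel adv ε) (θ j) x
    refine ⟨C, fun i y => ?_⟩
    by_cases hi : i = j
    · rw [hi, hrj]; exact hC y
    · rw [hri i hi, Real.log_one, abs_zero]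
      exact (abs_nonneg _).trans (hC 0)
  have := fun i => isProbabilityMeasure_armTriple (adv := adv) (up := decide (i = b)) hε (hθ i)
  have := fun i => isProbabilityMeasure_armTriple (adv := adv) (up := decide (i = j)) hε (hθ' i)
  -- The direction flags of `b` and `j` may differ between the two instances, but the sample laws
  -- ignore them, so only arm `j` is affected.
  have hd : ∀ (i : Fin k) (f : ℝ → ENNReal), Measurable f →
      ∫⁻ y, f y * ENNReal.ofReal (r i y) ∂((armTriple adv ε (θ i) (decide (i = b))).map mix) =
        ∫⁻ y, f y ∂((armTriple adv ε (θ' i) (decide (i = j))).map mix) := by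
    intro i f _
    rw [armTriple_map_mix hε (hθ i), armTriple_map_mix hε (hθ' i)]
    by_cases hi : i = j
    · rw [hi, hrj, hθ'j, lintegral_obsLaw_change hη (hθ j)]
    · rw [hri i hi, hθ'i i hi]
      simp
  refine (A.neg_integral_stoppedLlr_ge hr hpos hd hC n (A.measurableSet_missing j) hδ
    hsmall).trans (A.neg_integral_stoppedLlr_le hr hC ?_ (fun i hi y => by rw [hri i hi]) n)
  rw [armTriple_map_mix hε (hθ j), hrj]
  exact integral_log_obsDensity hη (hθ j) hx

/-- If the shifts `x j - θ j` are at most `3 / √(w j)`, a PAC algorithm needs at least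
`∑ j, w j log (1 / δ) / 20` samples, the sum running over all arms but one. -/
lemma exists_sum_le_expectedSamples (hε : ε ∈ Set.Ioo (0 : ℝ) (1 / 15)) {θ : Fin k → ℝ}
    (hθ : ∀ i, |θ i| ≤ 1 / 3) (b : Fin k) {x t α δ : ℝ} (hx : |x| ≤ 1 / 3)
    (ht : t ∈ Set.Ioo (0 : ℝ) (1 / 10)) (hα : 0 ≤ α) (hδ : δ ∈ Set.Ioo (0 : ℝ) (3 / 20))
    (hA : A.IsPAC adv ε t 4 (5 / 2) α δ) (hgap : ∀ i, α < x - θ i)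
    (hfin : A.expectedSamples (hardInstance adv hε hθ b) ≠ ⊤) {w : Fin k → ℝ}
    (hw : ∀ i, 0 ≤ w i) (hwx : ∀ i, w i * (x - θ i) ^ 2 ≤ 9) :
    ∃ j₀, 1 / 20 * (∑ j ∈ Finset.univ.erase j₀, w j * Real.log (1 / δ)) ≤
      (A.expectedSamples (hardInstance adv hε hθ b)).toReal := by
  set ν := hardInstance adv hε hθ b
  obtain ⟨j₀, hj₀⟩ := A.exists_outputs_le_half ν b
  refine ⟨j₀, ?_⟩
  set l := Real.log (1 / δ)
  have hl2 : Real.log 2 ≤ 3 / 8 * l := by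
    have h1 : Real.log (20 / 3) ≤ l := by
      refine Real.log_le_log (by norm_num) ?_
      rw [le_div_iff₀ hδ.1]
      linarith [hδ.2]
    -- Here `256 ≤ 8000 / 27`. The resulting factor 3/8 is below 1/2, which leaves `l / 8` after
    -- `log 2` is subtracted.
    have h2 : Real.log (2 ^ 8) ≤ Real.log ((20 / 3) ^ 3) :=
      Real.log_le_log (by norm_num) (by norm_num)
    rw [Real.log_pow, Real.log_pow] at h2
    push_cast at h2
    linarith
  have hl0 : 0 < l := by
    have := Real.log_pos (one_lt_two)
    linarith
  have harm : ∀ n, ∀ j ∈ Finset.univ.erase j₀,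
      5 / 9 * w j * (l / 8 - (A.jointLaw ν).real (A.continues n) * l) ≤
        A.pullCount ν (n + 1) j := by
    intro n j hj
    have h1 := A.stopsIn_missing_le_pullCount hε hθ b j hx ht hα hδ.1 hA (fun i _ => hgap i) (n + 1)
    have h2 := A.one_le_stopsIn_add ν n j
    have h3 := hj₀ j (Finset.ne_of_mem_erase hj)
    have h4 : 0 ≤ A.pullCount ν (n + 1) j := Finset.sum_nonneg fun _ _ => measureReal_nonneg
    have h5 : (1 / 2 - (A.jointLaw ν).real (A.continues n)) * l ≤
        (A.jointLaw ν).real (A.stopsIn (n + 1) (A.missing j)) * l :=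
      mul_le_mul_of_nonneg_right (by linarith) hl0.le
    have h6 : l / 8 - (A.jointLaw ν).real (A.continues n) * l ≤
        (x - θ j) ^ 2 / 5 * A.pullCount ν (n + 1) j := by linarith
    calc 5 / 9 * w j * (l / 8 - (A.jointLaw ν).real (A.continues n) * l)
        ≤ 5 / 9 * w j * ((x - θ j) ^ 2 / 5 * A.pullCount ν (n + 1) j) :=
          mul_le_mul_of_nonneg_left h6 (mul_nonneg (by norm_num) (hw j))
      _ = w j * (x - θ j) ^ 2 * (A.pullCount ν (n + 1) j / 9) := by ring
      _ ≤ 9 * (A.pullCount ν (n + 1) j / 9) :=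
          mul_le_mul_of_nonneg_right (hwx j) (by positivity)
      _ = A.pullCount ν (n + 1) j := by ring
  have hall : ∀ n, (∑ j ∈ Finset.univ.erase j₀, 5 / 9 * w j) *
      (l / 8 - (A.jointLaw ν).real (A.continues n) * l) ≤ (A.expectedSamples ν).toReal := by
    intro n
    rw [Finset.sum_mul]
    calc _ ≤ ∑ j ∈ Finset.univ.erase j₀, A.pullCount ν (n + 1) j := Finset.sum_le_sum (harm n)
      _ ≤ ∑ j, A.pullCount ν (n + 1) j := Finset.sum_le_sum_of_subset_of_nonneg
          (Finset.erase_subset _ _) fun _ _ _ => Finset.sum_nonneg fun _ _ => measureReal_nonneg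
      _ ≤ _ := by
          rw [A.sum_pullCount]
          exact A.sum_continues_le_toReal ν hfin (n + 1)
  -- As the horizon grows, the probability of still running vanishes because the expected sample
  -- count is finite. The limiting constant is `5/9 * 1/8 = 5/72`, which exceeds 1/20.
  have hlim := (((A.tendsto_continues ν hfin).mul_const l).const_sub (l / 8)).const_mul
    (∑ j ∈ Finset.univ.erase j₀, 5 / 9 * w j)
  have hle := le_of_tendsto' hlim hall
  rw [zero_mul, sub_zero, ← Finset.mul_sum] at hle
  rw [← Finset.sum_mul]
  have hS : 0 ≤ (∑ j ∈ Finset.univ.erase j₀, w j) * l :=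
    mul_nonneg (Finset.sum_nonneg fun j _ => hw j) hl0.le
  linarith

end Algorithm

end CBAI

end

theorem theorem4p3 :
    ∃ B : ℝ, 0 < B ∧ ∃ M : ℝ, 0 < M ∧ ∃ c : ℝ, 0 < c ∧
      ∀ (adv : CBAI.Adversary) (k : ℕ), 2 ≤ k →
      ∀ δ α ε t : ℝ,
        δ ∈ Set.Ioo (0 : ℝ) (3 / 20) → α ∈ Set.Ioo (0 : ℝ) (1 / 6) →
        ε ∈ Set.Ioo (0 : ℝ) (1 / 15) → t ∈ Set.Ioo (0 : ℝ) (1 / 10) →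
      ∀ (b : Fin k) (Δ : Fin k → ℝ), (∀ i, i ≠ b → Δ i ∈ Set.Ioo (0 : ℝ) (1 / 3)) →
      ∃ ν : CBAI.Instance k,
        ν.InClass adv ε t B M b ∧
        (∀ i, i ≠ b → ν.effectiveGap adv ε B b i = Δ i) ∧
        ∀ A : CBAI.Algorithm k, A.IsPAC adv ε t B M α δ →
          ENNReal.ofReal
              (c * ∑ i ∈ Finset.univ.erase b, 1 / (max (Δ i) α) ^ 2 * Real.log (1 / δ))
            ≤ A.expectedSamples ν := by
  refine ⟨4, by norm_num, 5 / 2, by norm_num, 1 / 20, by norm_num, ?_⟩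
  intro adv k _ δ α ε t hδ hα hε ht b Δ hΔ
  -- The value `Δ b` is unconstrained, so it is overwritten.
  set θ : Fin k → ℝ := Function.update (fun i => -Δ i) b 0
  have hθb : θ b = 0 := Function.update_self _ _ _
  have hθi : ∀ i ≠ b, θ i = -Δ i := fun i hi => Function.update_of_ne hi _ _
  have hθ0 : ∀ i, -(1 / 3) ≤ θ i ∧ θ i ≤ 0 := by
    intro i
    by_cases hi : i = b
    · rw [hi, hθb]; norm_num
    · rw [hθi i hi]
      constructor <;> linarith [(hΔ i hi).1, (hΔ i hi).2]
  have hθ : ∀ i, |θ i| ≤ 1 / 3 := fun i => abs_le.2 ⟨(hθ0 i).1, by linarith [(hθ0 i).2]⟩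
  refine ⟨CBAI.hardInstance adv hε hθ b, CBAI.hardInstance_inClass hε hθ b ht ?_, ?_, ?_⟩
  · intro i hi
    rw [hθb, hθi i hi]
    linarith [(hΔ i hi).1]
  · intro i hi
    rw [CBAI.hardInstance_effectiveGap hε hθ b hi, hθb, hθi i hi]
    ring
  · intro A hA
    by_cases hfin : A.expectedSamples (CBAI.hardInstance adv hε hθ b) = ⊤
    · rw [hfin]
      exact le_top
    let w : Fin k → ℝ := fun i => 1 / (max (-θ i) α) ^ 2
    have hmax : ∀ i, 0 < max (-θ i) α := fun i => lt_max_of_lt_right hα.1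
    have hw : ∀ i, 0 ≤ w i := fun i => by positivity
    -- The raised level `2 α` beats every `θ i ≤ 0` by more than `α`, stays within the allowed 1/3
    -- because `α < 1/6`, and costs a shift of at most `3 max (-θ i) α`.
    have hwx : ∀ i, w i * (2 * α - θ i) ^ 2 ≤ 9 := by
      intro i
      have h1 := le_max_left (-θ i) α
      have h2 := le_max_right (-θ i) α
      have h3 : (2 * α - θ i) ^ 2 ≤ 9 * (max (-θ i) α) ^ 2 := by
        have h4 : (2 * α - θ i) ^ 2 ≤ (3 * max (-θ i) α) ^ 2 :=
          pow_le_pow_left₀ (by linarith [hα.1, (hθ0 i).2]) (by linarith) 2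
        linarith
      simp only [w]
      rw [one_div_mul_eq_div, div_le_iff₀ (pow_pos (hmax i) 2)]
      exact h3
    obtain ⟨j₀, hj₀⟩ := A.exists_sum_le_expectedSamples hε hθ b (x := 2 * α)
      (by rw [abs_le]; constructor <;> linarith [hα.1, hα.2]) ht hα.1.le hδ hA
      (fun i => by linarith [hα.1, (hθ0 i).2]) hfin hw hwx
    refine ENNReal.ofReal_le_of_le_toReal (le_trans ?_ hj₀)
    have hl : 0 ≤ Real.log (1 / δ) :=
      Real.log_nonneg (by rw [le_div_iff₀ hδ.1]; linarith [hδ.2])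
    have hsum : ∑ i ∈ Finset.univ.erase b, 1 / (max (Δ i) α) ^ 2 * Real.log (1 / δ) =
        ∑ i ∈ Finset.univ.erase b, w i * Real.log (1 / δ) := by
      refine Finset.sum_congr rfl fun i hi => ?_
      simp only [w, hθi i (Finset.ne_of_mem_erase hi), neg_neg]
    -- The bound obtained omits `j₀` instead of `b`; as `b` has the largest weight, the sum without
    -- `b` is no larger.
    have hwb : w j₀ ≤ w b := by
      have h1 : max (-θ b) α = α := by
        rw [hθb, neg_zero]
        exact max_eq_right hα.1.le
      simp only [w, h1]
      exact one_div_le_one_div_of_le (pow_pos hα.1 2)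
        (pow_le_pow_left₀ hα.1.le (le_max_right _ _) 2)
    have h1 := Finset.sum_erase_add Finset.univ (fun i => w i * Real.log (1 / δ))
      (Finset.mem_univ b)
    have h2 := Finset.sum_erase_add Finset.univ (fun i => w i * Real.log (1 / δ))
      (Finset.mem_univ j₀)
    have h3 : w j₀ * Real.log (1 / δ) ≤ w b * Real.log (1 / δ) :=
      mul_le_mul_of_nonneg_right hwb hl
    rw [hsum]
    linarith
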